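/- \textbf{Conventions.} A pre-log ring $(A,M,\alpha)$ is a commutative ring $A$, a commutative monoid $M$ and a homomorphism $\alpha:M\to (A,\cdot)$; a map of pre-log rings is a compatible pair of a ring map and a monoid map. $M^{\mathrm{gp}}$ is the group completion of $M$. For a map of commutative monoids $P\to M$ and $n\ge 1$, let $\oplus_P^{n}M$ be the $n$-fold amalgamated sum $M\oplus_P\cdots\oplus_P M$, and let $$(\oplus_P^nM)^{\mathrm{rep}}=M\times_{M^{\mathrm{gp}}}(\oplus_P^nM)^{\mathrm{gp}}$$ be the repletion of the folding map $\oplus_P^nM\to M$. For a map of pre-log rings $(R,P)\to(A,M)$ and $n\ge1$ put $$B_n=A^{\otimes_R n}\otimes_{\mathbb Z[\oplus_P^nM]}\mathbb Z[(\oplus_P^nM)^{\mathrm{rep}}].$$ Every map of finite sets $\{0,\dots,k-1\}\to\{0,\dots,l-1\}$ induces a ring map $B_k\to B_l$ (multiply together the tensor factors, resp. the copies of $M$, that are sent to the same place). The ring $B_2$ acts on $A$ through the augmentation $B_2\to A$, which is the multiplication on $A\otimes_RA$ and the composite $(M\oplus_PM)^{\mathrm{rep}}\to M\xrightarrow{\alpha}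 A$ on the monoid. Let $C((A,M)/(R,P))$ be the chain complex of $A$-modules, concentrated in degrees $n\ge 0$, with $$C_n((A,M)/(R,P))=B_{n+1}=A^{\otimes_R (n+1)}\otimes_{\mathbb Z[\oplus_P^{n+1}M]}\mathbb Z[(\oplus_P^{n+1}M)^{\mathrm{rep}}],$$ where $A$ acts through the tensor factor $0$, with the Hochschild differential $\sum_{i=0}^n(-1)^id_i$; here $d_i:B_{n+1}\to B_n$ is the ring map that multiplies the positions $i$ and $i+1$ for $0\le i<n$, and the positions $n$ and $0$ for $i=n$. \textbf{Proposition.} Let $(R,P)\to(A,M)$ be a map of pre-log rings. Suppose that there are decompositions $P=P_1\oplus P_2$ and $M=M_1\oplus M_2$ such that $P\to M$ is the sum of maps $P_1\to M_1$ and $P_2\to M_2$, such that $P_2$ and $M_2$ are groups, and such that the induced ring map $R\otimes_{\mathbb Z[P_1]}\mathbb Z[M_1]\to A$ is flat. Then there is an isomorphism $$A\otimes^{\mathbb L}_{(A\otimes_RA)\otimes_{\mathbb Z[M\oplus_PM]}\mathbb Z[(M\oplus_PM)^{\mathrm{rep}}]}A\;\simeq\; C((A,M)/(R,P))$$ in the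 derived category of $A$-modules. -/

import Mathlib

open CategoryTheory

universe w u

noncomputable section

set_option linter.style.haveILetI false

namespace LogHH

/-! ### Pushouts of commutative rings -/

section RingPushout

variable {S B C : Type u} [CommRing S] [CommRing B] [CommRing C]

/-- The tensor product `B ⊗[S] C` of commutative rings along ring homomorphisms
`g : S →+* B` and `h : S →+* C`. -/
def RingPushout (g : S →+* B) (h : S →+* C) : Type u :=
  letI := g.toAlgebra
  letI := h.toAlgebra
  TensorProduct S B C

namespace RingPushout

variable (g : S →+* B) (h : S →+* C)

/-- The ring structure of the tensor product. -/
def commRing : CommRing (RingPushout g h) :=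
  letI := g.toAlgebra
  letI := h.toAlgebra
  (inferInstance : CommRing (TensorProduct S B C))

instance : CommRing (RingPushout g h) := commRing g h

/-- The map `b ↦ b ⊗ 1`. -/
def inl : B →+* RingPushout g h :=
  letI := g.toAlgebra
  letI := h.toAlgebra
  (Algebra.TensorProduct.includeLeftRingHom : B →+* TensorProduct S B C)

/-- The map `c ↦ 1 ⊗ c`. -/
def inr : C →+* RingPushout g h :=
  letI := g.toAlgebra
  letI := h.toAlgebra
  (Algebra.TensorProduct.includeRight : C →ₐ[S] TensorProduct S B C).toRingHom

variable {g h}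

/-- The ring homomorphism `b ⊗ c ↦ p b * q c`. -/
def lift {T : Type u} [CommRing T] (p : B →+* T) (q : C →+* T)
    (hpq : p.comp g = q.comp h) : RingPushout g h →+* T :=
  letI := g.toAlgebra
  letI := h.toAlgebra
  letI := (p.comp g).toAlgebra
  (Algebra.TensorProduct.lift (R := S) (S := S) (A := B) (B := C) (C := T)
    { p with commutes' := fun _ => rfl }
    { q with commutes' := fun s => (RingHom.congr_fun hpq s).symm }
    (fun _ _ => Commute.all _ _)).toRingHom

@[simp]
theorem lift_inl {T : Type u} [CommRing T] (p : B →+* T) (q : C →+* T)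
    (hpq : p.comp g = q.comp h) (b : B) : lift p q hpq (inl g h b) = p b := by
  letI := g.toAlgebra
  letI := h.toAlgebra
  letI := (p.comp g).toAlgebra
  exact (Algebra.TensorProduct.lift_tmul _ _ _ _ _).trans
    ((congrArg (p b * ·) (map_one q)).trans (mul_one _))

@[simp]
theorem lift_inr {T : Type u} [CommRing T] (p : B →+* T) (q : C →+* T)
    (hpq : p.comp g = q.comp h) (c : C) : lift p q hpq (inr g h c) = q c := by
  letI := g.toAlgebra
  letI := h.toAlgebra
  letI := (p.comp g).toAlgebra
  exact (Algebra.TensorProduct.lift_tmul _ _ _ _ _).trans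
    ((congrArg (· * q c) (map_one p)).trans (one_mul _))

theorem inl_comp : (inl g h).comp g = (inr g h).comp h := by
  letI := g.toAlgebra
  letI := h.toAlgebra
  ext s
  exact (Algebra.TensorProduct.includeRight : C →ₐ[S] TensorProduct S B C).commutes s |>.symm

theorem hom_ext {T : Type u} [CommRing T] {p q : RingPushout g h →+* T}
    (hl : p.comp (inl g h) = q.comp (inl g h)) (hr : p.comp (inr g h) = q.comp (inr g h)) :
    p = q := by
  letI := g.toAlgebra
  letI := h.toAlgebra
  ext x
  induction x using TensorProduct.induction_on with
  | zero => exact (map_zero p).trans (map_zero q).symm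
  | tmul b c =>
    have e : (TensorProduct.tmul S b c : TensorProduct S B C) =
        (TensorProduct.tmul S b 1) * (TensorProduct.tmul S 1 c) := by
      rw [Algebra.TensorProduct.tmul_mul_tmul, mul_one, one_mul]
    rw [e]
    exact (map_mul p (inl g h b) (inr g h c)).trans
      ((congrArg₂ (· * ·) (RingHom.congr_fun hl b) (RingHom.congr_fun hr c)).trans
        (map_mul q (inl g h b) (inr g h c)).symm)
  | add x y hx hy => exact (map_add p x y).trans ((congrArg₂ (· + ·) hx hy).trans (map_add q x y).symm)

end RingPushout

end RingPushout

/-! ### Amalgamated sums and repletion of commutative monoids -/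

section Monoids

variable {P M N : Type u} [CommMonoid P] [CommMonoid M] [CommMonoid N]

/-- The relation on `P × M ^ n` that glues the copy of `P` to each copy of `M`. -/
inductive AmalgRel (φ : P →* M) (n : ℕ) : P × (Fin n → M) → P × (Fin n → M) → Prop
  | glue (i : Fin n) (p : P) : AmalgRel φ n (p, 1) (1, Pi.mulSingle i (φ p))

/-- The `n`-fold amalgamated sum `M ⊕_P ⋯ ⊕_P M` in the category of commutative monoids. -/
def Amalg (φ : P →* M) (n : ℕ) : Type u := (conGen (AmalgRel φ n)).Quotient

namespace Amalg

instance (φ : P →* M) (n : ℕ) : CommMonoid (Amalg φ n) :=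
  inferInstanceAs (CommMonoid (conGen (AmalgRel φ n)).Quotient)

variable (φ : P →* M) (n : ℕ)

/-- The quotient map from `P × M ^ n`. -/
def mk : P × (Fin n → M) →* Amalg φ n := (conGen (AmalgRel φ n)).mk'

/-- The canonical map from `P`. -/
def base : P →* Amalg φ n := (mk φ n).comp (MonoidHom.inl P (Fin n → M))

/-- The canonical map from the `i`-th copy of `M`. -/
def ι (i : Fin n) : M →* Amalg φ n :=
  (mk φ n).comp ((MonoidHom.inr P (Fin n → M)).comp (MonoidHom.mulSingle (fun _ => M) i))

variable {φ n}

theorem ι_comp (i : Fin n) : (ι φ n i).comp φ = base φ n := by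
  ext p
  exact ((Con.eq _).mpr (ConGen.Rel.of _ _ (AmalgRel.glue i p))).symm

theorem hom_ext {T : Type*} [CommMonoid T] {f g : Amalg φ n →* T}
    (hb : f.comp (base φ n) = g.comp (base φ n))
    (hι : ∀ i, f.comp (ι φ n i) = g.comp (ι φ n i)) : f = g := by
  have key : f.comp (mk φ n) = g.comp (mk φ n) := by
    refine MonoidHom.ext fun x => ?_
    have h1 : (f.comp (mk φ n)).comp (MonoidHom.inr P (Fin n → M)) =
        (g.comp (mk φ n)).comp (MonoidHom.inr P (Fin n → M)) :=
      MonoidHom.pi_ext fun i m => DFunLike.congr_fun (hι i) m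
    have hx : x = (x.1, 1) * (1, x.2) := by simp
    rw [hx, map_mul, map_mul]
    exact congrArg₂ (· * ·) (DFunLike.congr_fun hb x.1) (DFunLike.congr_fun h1 x.2)
  refine MonoidHom.ext fun x => ?_
  obtain ⟨y, rfl⟩ := Con.mk'_surjective x
  exact DFunLike.congr_fun key y

theorem prod_mulSingle {T : Type*} [CommMonoid T] (g : Fin n → M →* T) (i : Fin n) (m : M) :
    (∏ j, (g j).comp (Pi.evalMonoidHom (fun _ : Fin n => M) j)) (Pi.mulSingle i m) = g i m := by
  rw [MonoidHom.finsetProd_apply, Finset.prod_eq_single i]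
  · simp
  · intro j _ hj
    simp [Pi.mulSingle_eq_of_ne hj]
  · simp

/-- The universal property of the amalgamated sum: `g i` on the `i`-th copy of `M`. -/
def lift {T : Type*} [CommMonoid T] (b : P →* T) (g : Fin n → M →* T)
    (h : ∀ i, (g i).comp φ = b) : Amalg φ n →* T :=
  (conGen (AmalgRel φ n)).lift
    (b.coprod (∏ i, (g i).comp (Pi.evalMonoidHom (fun _ : Fin n => M) i)))
    (Con.conGen_le.mpr (by
      rintro _ _ ⟨i, p⟩
      rw [Con.ker_apply]
      rw [MonoidHom.coprod_apply, MonoidHom.coprod_apply, prod_mulSingle, map_one, map_one, one_mul,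
        mul_one, ← h i]
      rfl))

@[simp]
theorem lift_base {T : Type*} [CommMonoid T] (b : P →* T) (g : Fin n → M →* T)
    (h : ∀ i, (g i).comp φ = b) (p : P) : lift b g h (base φ n p) = b p := by
  refine (Con.lift_mk' _ _).trans ?_
  simp [MonoidHom.coprod_apply]

@[simp]
theorem lift_ι {T : Type*} [CommMonoid T] (b : P →* T) (g : Fin n → M →* T)
    (h : ∀ i, (g i).comp φ = b) (i : Fin n) (m : M) : lift b g h (ι φ n i m) = g i m := by
  refine (Con.lift_mk' _ _).trans ?_
  exact (congrArg₂ (· * ·) (map_one b) (prod_mulSingle g i m)).trans (one_mul _)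

variable (φ) in
/-- The map of amalgamated sums that sends the `i`-th copy of `M` to the `c i`-th one. -/
def map {k l : ℕ} (c : Fin k → Fin l) : Amalg φ k →* Amalg φ l :=
  lift (base φ l) (fun i => ι φ l (c i)) (fun i => ι_comp (c i))

variable (φ n) in
/-- The folding map `M ⊕_P ⋯ ⊕_P M → M`, the identity on each copy of `M`. -/
def fold : Amalg φ n →* M := lift φ (fun _ => MonoidHom.id M) (fun _ => rfl)

theorem map_id : map φ (id : Fin n → Fin n) = MonoidHom.id _ :=
  hom_ext (by ext; simp [map]) (fun i => by ext; simp [map])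

theorem map_comp {j k l : ℕ} (c : Fin j → Fin k) (d : Fin k → Fin l) :
    (map φ d).comp (map φ c) = map φ (d ∘ c) :=
  hom_ext (by ext; simp [map]) (fun i => by ext; simp [map])

theorem fold_comp_map {k l : ℕ} (c : Fin k → Fin l) : (fold φ l).comp (map φ c) = fold φ k :=
  hom_ext (by ext; simp [map, fold]) (fun i => by ext; simp [map, fold])

end Amalg

/-- The homomorphism `M^gp → N^gp` induced by `g : M → N`. -/
def gpMap (g : M →* N) : Algebra.GrothendieckGroup M →* Algebra.GrothendieckGroup N :=
  Algebra.GrothendieckGroup.lift (Algebra.GrothendieckGroup.of.comp g)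

theorem gpMap_of (g : M →* N) (m : M) :
    gpMap g (Algebra.GrothendieckGroup.of m) = Algebra.GrothendieckGroup.of (g m) :=
  DFunLike.congr_fun (Algebra.GrothendieckGroup.lift.symm_apply_apply
    (Algebra.GrothendieckGroup.of.comp g)) m

theorem gp_hom_ext {G : Type*} [CommGroup G] {a b : Algebra.GrothendieckGroup M →* G}
    (h : a.comp Algebra.GrothendieckGroup.of = b.comp Algebra.GrothendieckGroup.of) : a = b :=
  Algebra.GrothendieckGroup.lift.symm.injective h

theorem gpMap_id : gpMap (MonoidHom.id M) = MonoidHom.id _ :=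
  gp_hom_ext (MonoidHom.ext fun m => gpMap_of _ m)

theorem gpMap_comp {L : Type u} [CommMonoid L] (g : M →* N) (h : N →* L) :
    (gpMap h).comp (gpMap g) = gpMap (h.comp g) :=
  gp_hom_ext (MonoidHom.ext fun m =>
    (congrArg (gpMap h) (gpMap_of g m)).trans ((gpMap_of h (g m)).trans (gpMap_of (h.comp g) m).symm))

/-- The repletion `M^rep = N ×_{N^gp} M^gp` of a homomorphism `g : M → N`. -/
def repletion (g : M →* N) : Submonoid (N × Algebra.GrothendieckGroup M) :=
  (Algebra.GrothendieckGroup.of.comp (MonoidHom.fst N (Algebra.GrothendieckGroup M))).eqLocusM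
    ((gpMap g).comp (MonoidHom.snd N (Algebra.GrothendieckGroup M)))

/-- The canonical map `M → M^rep`, `m ↦ (g m, m)`. -/
def toRepletion (g : M →* N) : M →* repletion g :=
  (g.prod Algebra.GrothendieckGroup.of).codRestrict (repletion g) (fun m => (gpMap_of g m).symm)

variable (φ : P →* M) (n : ℕ)

/-- `(⊕_P^n M)^rep`, the repletion of the folding map. -/
abbrev RepAmalg : Type u := repletion (Amalg.fold φ n)

/-- The map of repletions induced by a map of index sets. -/
def RepAmalg.map {k l : ℕ} (c : Fin k → Fin l) : RepAmalg φ k →* RepAmalg φ l :=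
  (((MonoidHom.id M).prodMap (gpMap (Amalg.map φ c))).comp
    (repletion (Amalg.fold φ k)).subtype).codRestrict (repletion (Amalg.fold φ l)) (by
      intro x
      have hx : Algebra.GrothendieckGroup.of x.1.1 = gpMap (Amalg.fold φ k) x.1.2 := x.2
      change Algebra.GrothendieckGroup.of x.1.1 =
        gpMap (Amalg.fold φ l) (gpMap (Amalg.map φ c) x.1.2)
      refine hx.trans (Eq.symm ?_)
      have h := gpMap_comp (Amalg.map φ c) (Amalg.fold φ l)
      rw [Amalg.fold_comp_map] at h
      exact DFunLike.congr_fun h x.1.2)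

theorem RepAmalg.map_id : RepAmalg.map φ (id : Fin n → Fin n) = MonoidHom.id _ := by
  ext x
  · rfl
  · change gpMap (Amalg.map φ id) x.1.2 = x.1.2
    rw [Amalg.map_id, gpMap_id]
    rfl

theorem RepAmalg.map_comp {j k l : ℕ} (c : Fin j → Fin k) (d : Fin k → Fin l) :
    (RepAmalg.map φ d).comp (RepAmalg.map φ c) = RepAmalg.map φ (d ∘ c) := by
  ext x
  · rfl
  · change gpMap (Amalg.map φ d) (gpMap (Amalg.map φ c) x.1.2) =
      gpMap (Amalg.map φ (d ∘ c)) x.1.2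
    rw [← Amalg.map_comp, ← gpMap_comp]
    rfl

theorem RepAmalg.map_comp_toRepletion {k l : ℕ} (c : Fin k → Fin l) :
    (RepAmalg.map φ c).comp (toRepletion (Amalg.fold φ k)) =
      (toRepletion (Amalg.fold φ l)).comp (Amalg.map φ c) := by
  ext x
  · exact (DFunLike.congr_fun (Amalg.fold_comp_map (φ := φ) c) x).symm
  · exact gpMap_of _ _

/-- The projection `(⊕_P^n M)^rep → M`. -/
def RepAmalg.fold : RepAmalg φ n →* M :=
  (MonoidHom.fst M (Algebra.GrothendieckGroup (Amalg φ n))).comp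
    (repletion (Amalg.fold φ n)).subtype

@[simp]
theorem RepAmalg.fold_toRepletion (x : Amalg φ n) :
    RepAmalg.fold φ n (toRepletion (Amalg.fold φ n) x) = Amalg.fold φ n x := rfl

/-- The homomorphism of monoid rings `ℤ[M] → ℤ[N]` induced by `g : M → N`. -/
abbrev monoidRingMap (g : M →* N) : MonoidAlgebra ℤ M →+* MonoidAlgebra ℤ N :=
  MonoidAlgebra.mapDomainRingHom ℤ g

/-- The ring homomorphism `ℤ[M] → T` induced by a homomorphism `M → T` to a multiplicative monoid
of a commutative ring. -/
def monoidRingLift {T : Type*} [CommRing T] (g : M →* T) : MonoidAlgebra ℤ M →+* T :=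
  (MonoidAlgebra.lift ℤ T M g).toRingHom

@[simp]
theorem monoidRingLift_of {T : Type*} [CommRing T] (g : M →* T) (m : M) :
    monoidRingLift g (MonoidAlgebra.of ℤ M m) = g m := by
  simp [monoidRingLift]

theorem monoidRing_hom_ext {T : Type*} [CommRing T] {p q : MonoidAlgebra ℤ M →+* T}
    (h : ∀ m, p (MonoidAlgebra.of ℤ M m) = q (MonoidAlgebra.of ℤ M m)) : p = q :=
  MonoidAlgebra.ringHom_ext
    (fun r => DFunLike.congr_fun (RingHom.ext_int
      (p.comp MonoidAlgebra.singleOneRingHom) (q.comp MonoidAlgebra.singleOneRingHom)) r) h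

end Monoids

/-! ### Pre-log rings -/

/-- A pre-log ring `(A, M, α)`. -/
structure PreLogRing where
  /-- The commutative ring. -/
  Ring : Type u
  [commRing : CommRing Ring]
  /-- The commutative monoid. -/
  Mon : Type u
  [commMonoid : CommMonoid Mon]
  /-- The structure map. -/
  α : Mon →* Ring

attribute [instance] PreLogRing.commRing PreLogRing.commMonoid

/-- A map of pre-log rings `(R, P) → (A, M)`. -/
structure PreLogHom (X Y : PreLogRing.{u}) where
  /-- The map of rings. -/
  ring : X.Ring →+* Y.Ring
  /-- The map of monoids. -/
  mon : X.Mon →* Y.Mon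
  comm : ∀ p, Y.α (mon p) = ring (X.α p)

namespace PreLogHom

variable {X Y : PreLogRing.{u}} (f : PreLogHom X Y)

/-- For `f : (R, P) → (A, M)`, the `n`-fold tensor power `A ⊗_R ⋯ ⊗_R A`. -/
def TPow (n : ℕ) : Type u :=
  letI := f.ring.toAlgebra
  PiTensorProduct X.Ring (fun _ : Fin n => Y.Ring)

namespace TPow

/-- The ring structure of the tensor power. -/
def commRing (n : ℕ) : CommRing (f.TPow n) :=
  letI := f.ring.toAlgebra
  (inferInstance : CommRing (PiTensorProduct X.Ring (fun _ : Fin n => Y.Ring)))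

instance (n : ℕ) : CommRing (f.TPow n) := commRing f n

/-- The structure map `R → A ⊗_R ⋯ ⊗_R A`. -/
def base (n : ℕ) : X.Ring →+* f.TPow n :=
  letI := f.ring.toAlgebra
  algebraMap X.Ring (PiTensorProduct X.Ring (fun _ : Fin n => Y.Ring))

/-- The map `a ↦ 1 ⊗ ⋯ ⊗ a ⊗ ⋯ ⊗ 1`, with `a` in position `i`. -/
def ι (n : ℕ) (i : Fin n) : Y.Ring →+* f.TPow n :=
  letI := f.ring.toAlgebra
  (PiTensorProduct.singleAlgHom (R := X.Ring) (A := fun _ : Fin n => Y.Ring) i).toRingHom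

/-- The pure tensor `a 0 ⊗ ⋯ ⊗ a (n - 1)`. -/
def pure {n : ℕ} (a : Fin n → Y.Ring) : f.TPow n :=
  letI := f.ring.toAlgebra
  PiTensorProduct.tprod X.Ring a

variable {f} {n : ℕ}

theorem ι_comp (i : Fin n) : (ι f n i).comp f.ring = base f n := by
  letI := f.ring.toAlgebra
  exact (PiTensorProduct.singleAlgHom (R := X.Ring) (A := fun _ : Fin n => Y.Ring) i).comp_algebraMap

theorem pure_eq_prod (a : Fin n → Y.Ring) : pure f a = ∏ i, ι f n i (a i) := by
  letI := f.ring.toAlgebra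
  have h : a = ∏ i, Pi.mulSingle i (a i) := (Finset.univ_prod_mulSingle a).symm
  have := PiTensorProduct.tprod_prod (R := X.Ring) Finset.univ
    (fun i => (Pi.mulSingle i (a i) : Fin n → Y.Ring))
  exact (congrArg (PiTensorProduct.tprod X.Ring) h).trans this

theorem hom_ext {T : Type*} [CommRing T] {p q : f.TPow n →+* T}
    (hb : p.comp (base f n) = q.comp (base f n))
    (hι : ∀ i, p.comp (ι f n i) = q.comp (ι f n i)) : p = q := by
  letI := f.ring.toAlgebra
  letI := (p.comp (base f n)).toAlgebra
  let p' : PiTensorProduct X.Ring (fun _ : Fin n => Y.Ring) →ₐ[X.Ring] T :=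
    { p with commutes' := fun _ => rfl }
  let q' : PiTensorProduct X.Ring (fun _ : Fin n => Y.Ring) →ₐ[X.Ring] T :=
    { q with commutes' := fun r => (RingHom.congr_fun hb r).symm }
  have : p' = q' := PiTensorProduct.algHom_ext fun i =>
    AlgHom.ext fun a => RingHom.congr_fun (hι i) a
  exact RingHom.ext fun x => DFunLike.congr_fun this x

/-- The universal property of the tensor power as a coproduct of `R`-algebras:
`a 0 ⊗ ⋯ ⊗ a (n - 1) ↦ ∏ i, g i (a i)`. -/
def lift {T : Type*} [CommRing T] (b : X.Ring →+* T) (g : Fin n → Y.Ring →+* T)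
    (h : ∀ i, (g i).comp f.ring = b) : f.TPow n →+* T :=
  letI := f.ring.toAlgebra
  letI := b.toAlgebra
  (PiTensorProduct.liftAlgHom (R := X.Ring) (A := fun _ : Fin n => Y.Ring)
    ((MultilinearMap.mkPiAlgebra X.Ring (Fin n) T).compLinearMap
      (fun i => AlgHom.toLinearMap
        ({ g i with commutes' := fun r => RingHom.congr_fun (h i) r } : Y.Ring →ₐ[X.Ring] T)))
    (by simp) (fun x y => by simp [Finset.prod_mul_distrib])).toRingHom

theorem lift_pure {T : Type*} [CommRing T] (b : X.Ring →+* T) (g : Fin n → Y.Ring →+* T)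
    (h : ∀ i, (g i).comp f.ring = b) (a : Fin n → Y.Ring) :
    lift b g h (pure f a) = ∏ i, g i (a i) := by
  letI := f.ring.toAlgebra
  letI := b.toAlgebra
  exact PiTensorProduct.lift.tprod (R := X.Ring) (s := fun _ : Fin n => Y.Ring) a

@[simp]
theorem lift_base {T : Type*} [CommRing T] (b : X.Ring →+* T) (g : Fin n → Y.Ring →+* T)
    (h : ∀ i, (g i).comp f.ring = b) (r : X.Ring) : lift b g h (base f n r) = b r := by
  letI := f.ring.toAlgebra
  letI := b.toAlgebra
  exact AlgHom.commutes (PiTensorProduct.liftAlgHom (R := X.Ring) (A := fun _ : Fin n => Y.Ring)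
    _ _ _) r

@[simp]
theorem lift_ι {T : Type*} [CommRing T] (b : X.Ring →+* T) (g : Fin n → Y.Ring →+* T)
    (h : ∀ i, (g i).comp f.ring = b) (i : Fin n) (a : Y.Ring) :
    lift b g h (ι f n i a) = g i a := by
  refine (lift_pure b g h (Pi.mulSingle i a)).trans ?_
  rw [Finset.prod_eq_single i]
  · simp
  · intro j _ hj
    simp [Pi.mulSingle_eq_of_ne hj]
  · simp

variable (f) in
/-- The ring homomorphism of tensor powers that sends the `i`-th factor to the `c i`-th one. -/
def map {k l : ℕ} (c : Fin k → Fin l) : f.TPow k →+* f.TPow l :=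
  lift (base f l) (fun i => ι f l (c i)) (fun i => ι_comp (c i))

theorem map_id : map f (id : Fin n → Fin n) = RingHom.id _ :=
  hom_ext (by ext; simp [map]) (fun i => by ext; simp [map])

theorem map_comp {j k l : ℕ} (c : Fin j → Fin k) (d : Fin k → Fin l) :
    (map f d).comp (map f c) = map f (d ∘ c) :=
  hom_ext (by ext; simp [map]) (fun i => by ext; simp [map])

/-- On pure tensors the map multiplies the factors that go to the same position. -/
theorem map_pure {k l : ℕ} (c : Fin k → Fin l) (a : Fin k → Y.Ring) :
    map f c (pure f a) = pure f (fun j => ∏ i with c i = j, a i) := by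
  rw [map, lift_pure, pure_eq_prod, ← Finset.prod_fiberwise Finset.univ c]
  refine Finset.prod_congr rfl fun j _ => ?_
  rw [map_prod]
  refine Finset.prod_congr rfl fun i hi => ?_
  rw [(Finset.mem_filter.mp hi).2]

variable (f n) in
/-- The multiplication `A ⊗_R ⋯ ⊗_R A → A`. -/
def fold : f.TPow n →+* Y.Ring := lift f.ring (fun _ => RingHom.id _) (fun _ => rfl)

end TPow

/-- The map of monoids `M ⊕_P ⋯ ⊕_P M → A ⊗_R ⋯ ⊗_R A` induced by `α : M → A` on each copy. -/
def amalgToTPow (n : ℕ) : Amalg f.mon n →* f.TPow n :=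
  Amalg.lift ((TPow.base f n).toMonoidHom.comp X.α)
    (fun i => (TPow.ι f n i).toMonoidHom.comp Y.α)
    (fun i => by
      ext p
      have := RingHom.congr_fun (TPow.ι_comp (f := f) i) (X.α p)
      simpa [f.comm] using this)

/-- The ring
`B_n = (A ⊗_R ⋯ ⊗_R A) ⊗_{ℤ[M ⊕_P ⋯ ⊕_P M]} ℤ[(M ⊕_P ⋯ ⊕_P M)^rep]`, with `n` copies of `A` and
of `M`. -/
abbrev Bar (n : ℕ) : Type u :=
  RingPushout (monoidRingLift (f.amalgToTPow n))
    (monoidRingMap (toRepletion (Amalg.fold f.mon n)))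

namespace Bar

/-- The ring homomorphism `B_k → B_l` induced by a map of index sets. -/
def map {k l : ℕ} (c : Fin k → Fin l) : f.Bar k →+* f.Bar l :=
  RingPushout.lift ((RingPushout.inl _ _).comp (TPow.map f c))
    ((RingPushout.inr _ _).comp (monoidRingMap (RepAmalg.map f.mon c)))
    (by
      have h1 : (TPow.map f c).comp (monoidRingLift (f.amalgToTPow k)) =
          (monoidRingLift (f.amalgToTPow l)).comp (monoidRingMap (Amalg.map f.mon c)) := by
        have h2 : (TPow.map f c).toMonoidHom.comp (f.amalgToTPow k) =
            (f.amalgToTPow l).comp (Amalg.map f.mon c) :=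
          Amalg.hom_ext (by ext; simp [amalgToTPow, Amalg.map, TPow.map])
            (fun i => by ext; simp [amalgToTPow, Amalg.map, TPow.map])
        refine monoidRing_hom_ext fun m => ?_
        have := DFunLike.congr_fun h2 m
        simpa [monoidRingLift] using this
      have h3 : (monoidRingMap (RepAmalg.map f.mon c)).comp
            (monoidRingMap (toRepletion (Amalg.fold f.mon k))) =
          (monoidRingMap (toRepletion (Amalg.fold f.mon l))).comp
            (monoidRingMap (Amalg.map f.mon c)) := by
        refine monoidRing_hom_ext fun m => ?_
        have := DFunLike.congr_fun (RepAmalg.map_comp_toRepletion f.mon c) m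
        simpa using congrArg (fun y => MonoidAlgebra.single y (1 : ℤ)) this
      rw [RingHom.comp_assoc, RingHom.comp_assoc, h1, h3, ← RingHom.comp_assoc,
        ← RingHom.comp_assoc, RingPushout.inl_comp])

theorem map_id (n : ℕ) : map f (id : Fin n → Fin n) = RingHom.id _ := by
  refine RingPushout.hom_ext ?_ ?_
  · ext x
    simp [map, TPow.map_id]
  · refine monoidRing_hom_ext fun m => ?_
    simp [map, RepAmalg.map_id]

theorem map_comp {j k l : ℕ} (c : Fin j → Fin k) (d : Fin k → Fin l) :
    (map f d).comp (map f c) = map f (d ∘ c) := by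
  refine RingPushout.hom_ext ?_ ?_
  · ext x
    simp [map, ← TPow.map_comp]
  · refine monoidRing_hom_ext fun m => ?_
    simp [map, ← RepAmalg.map_comp]

/-- The map `A → B_n` given by the `i`-th tensor factor. -/
def ι (n : ℕ) (i : Fin n) : Y.Ring →+* f.Bar n := (RingPushout.inl _ _).comp (TPow.ι f n i)

theorem map_ι {k l : ℕ} (c : Fin k → Fin l) (i : Fin k) (a : Y.Ring) :
    map f c (ι f k i a) = ι f l (c i) a := by
  simp [map, ι, TPow.map]

/-- The augmentation `B_n → A`: multiplication on the tensor factors, and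
`(M ⊕_P ⋯ ⊕_P M)^rep → M → A` on the monoid. -/
def fold (n : ℕ) : f.Bar n →+* Y.Ring :=
  RingPushout.lift (TPow.fold f n) (monoidRingLift (Y.α.comp (RepAmalg.fold f.mon n)))
    (by
      have h : (TPow.fold f n).toMonoidHom.comp (f.amalgToTPow n) =
          Y.α.comp (Amalg.fold f.mon n) :=
        Amalg.hom_ext (by ext; simp [amalgToTPow, Amalg.fold, TPow.fold, f.comm])
          (fun i => by ext; simp [amalgToTPow, Amalg.fold, TPow.fold])
      refine monoidRing_hom_ext fun m => ?_
      have h' := DFunLike.congr_fun h m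
      simpa [monoidRingLift] using h')

end Bar

end PreLogHom

/-! ### The simplicial circle and the cyclic bar construction -/

/-- The action of a monotone map `θ : [m] → [n]` on the simplicial circle, whose set of `n`-simplices
is `{0, …, n}`: the simplex `k` stands for the map `[n] → [1]` with `i ↦ 0` iff `i < k`, with
the two constant maps identified (so that `n + 1` is `0`), and `θ` acts by precomposition. -/
def circle {m n : SimplexCategory} (θ : m ⟶ n) (k : Fin (n.len + 1)) : Fin (m.len + 1) :=
  Fin.ofNat (m.len + 1) (Finset.card {i : Fin (m.len + 1) | θ.toOrderHom i < k})

theorem lt_iff_lt_card {m n : SimplexCategory} (θ : m ⟶ n) (k : Fin (n.len + 1))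
    (j : Fin (m.len + 1)) :
    θ.toOrderHom j < k ↔ (j : ℕ) < Finset.card {i : Fin (m.len + 1) | θ.toOrderHom i < k} := by
  constructor
  · intro hj
    have : Finset.Iic j ⊆ ({i : Fin (m.len + 1) | θ.toOrderHom i < k} : Finset _) := fun i hi =>
      Finset.mem_filter.mpr ⟨Finset.mem_univ _,
        (θ.toOrderHom.monotone (Finset.mem_Iic.mp hi)).trans_lt hj⟩
    have := Finset.card_le_card this
    rw [Fin.card_Iic] at this
    omega
  · intro hj
    by_contra hk
    have : ({i : Fin (m.len + 1) | θ.toOrderHom i < k} : Finset _) ⊆ Finset.Iio j := fun i hi => by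
      rw [Finset.mem_Iio]
      by_contra h
      exact hk ((θ.toOrderHom.monotone (not_lt.mp h)).trans_lt (Finset.mem_filter.mp hi).2)
    have := Finset.card_le_card this
    rw [Fin.card_Iio] at this
    omega

theorem circle_zero {m n : SimplexCategory} (θ : m ⟶ n) : circle θ 0 = 0 := by
  simp [circle]

theorem circle_id (n : SimplexCategory) : circle (𝟙 n) = id := by
  funext k
  have : ({i : Fin (n.len + 1) | i < k} : Finset _) = Finset.Iio k := by ext; simp
  simp [circle, this]

theorem circle_comp {l m n : SimplexCategory} (ψ : l ⟶ m) (θ : m ⟶ n) :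
    circle (ψ ≫ θ) = circle ψ ∘ circle θ := by
  funext k
  have hcomp : ∀ i, (ψ ≫ θ).toOrderHom i = θ.toOrderHom (ψ.toOrderHom i) := fun _ => rfl
  have key := lt_iff_lt_card θ k
  change _ = circle ψ (circle θ k)
  set c := Finset.card {i : Fin (m.len + 1) | θ.toOrderHom i < k} with hc
  have hle : c ≤ m.len + 1 := by
    simpa using Finset.card_le_univ ({i : Fin (m.len + 1) | θ.toOrderHom i < k} : Finset _)
  rcases hle.lt_or_eq with hlt | heq
  · have hv : ((circle θ k : Fin (m.len + 1)) : ℕ) = c := by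
      simp only [circle, ← hc, Fin.val_ofNat]
      exact Nat.mod_eq_of_lt hlt
    have : ∀ i, (ψ ≫ θ).toOrderHom i < k ↔ ψ.toOrderHom i < circle θ k := fun i => by
      rw [hcomp, key, Fin.lt_def, hv]
    have hs : (Finset.univ.filter fun i : Fin (l.len + 1) => (ψ ≫ θ).toOrderHom i < k) =
        Finset.univ.filter fun i : Fin (l.len + 1) => ψ.toOrderHom i < circle θ k := Finset.filter_congr fun i _ => this i
    exact congrArg (fun s => Fin.ofNat (l.len + 1) (Finset.card s)) hs
  · have h0 : circle θ k = 0 := by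
      ext
      simp [circle, ← hc, heq]
    have : ∀ i, (ψ ≫ θ).toOrderHom i < k := fun i => by
      rw [hcomp, key, heq]
      exact (ψ.toOrderHom i).2
    have hs : ({i : Fin (l.len + 1) | (ψ ≫ θ).toOrderHom i < k} : Finset _) = Finset.univ :=
      Finset.filter_true_of_mem fun i _ => this i
    rw [h0, circle_zero]
    refine (congrArg (fun s => Fin.ofNat (l.len + 1) (Finset.card s)) hs).trans ?_
    ext
    simp

/-- The face `d_i`, `i ≤ n`, identifies the positions `i` and `i + 1`. -/
theorem circle_δ_castSucc {n : ℕ} (i : Fin (n + 1)) :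
    circle (SimplexCategory.δ i.castSucc) = (i.predAbove : Fin (n + 2) → Fin (n + 1)) := by
  funext k
  have hs : ∀ j : Fin (n + 1), (SimplexCategory.δ i.castSucc).toOrderHom j < k ↔
      j < (i.predAbove k : Fin (n + 1)) := fun j => by
    change i.castSucc.succAbove j < k ↔ _
    have h0 : (i.castSucc : ℕ) = i := rfl
    simp only [Fin.succAbove, Fin.predAbove, Fin.lt_def, h0]
    split_ifs <;> simp_all [-Fin.val_fin_lt] <;> omega
  have hs' : (Finset.univ.filter fun j : Fin (n + 1) =>
      (SimplexCategory.δ i.castSucc).toOrderHom j < k) = Finset.Iio (i.predAbove k) := by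
    ext j
    rw [Finset.mem_filter, Finset.mem_Iio]
    exact ⟨fun h => (hs j).mp h.2, fun h => ⟨Finset.mem_univ _, (hs j).mpr h⟩⟩
  refine (congrArg (fun s => Fin.ofNat (n + 1) (Finset.card s)) hs').trans ?_
  simp

/-- The last face `d_{n+1}` moves the last position to position `0`. -/
theorem circle_δ_last {n : ℕ} :
    circle (SimplexCategory.δ (Fin.last (n + 1))) =
      (Fin.lastCases 0 id : Fin (n + 2) → Fin (n + 1)) := by
  funext k
  have hs : ∀ j : Fin (n + 1),
      (SimplexCategory.δ (Fin.last (n + 1))).toOrderHom j < k ↔ (j : ℕ) < k := fun j => by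
    change (Fin.last (n + 1)).succAbove j < k ↔ _
    simp [Fin.lt_def]
  have hs' : (Finset.univ.filter fun j : Fin (n + 1) =>
      (SimplexCategory.δ (Fin.last (n + 1))).toOrderHom j < k) =
      Finset.univ.filter fun j : Fin (n + 1) => (j : ℕ) < k := Finset.filter_congr fun j _ => hs j
  refine (congrArg (fun s => Fin.ofNat (n + 1) (Finset.card s)) hs').trans ?_
  cases k using Fin.lastCases with
  | last =>
    have : (Finset.univ.filter fun j : Fin (n + 1) => (j : ℕ) < Fin.last (n + 1)) = Finset.univ :=
      Finset.filter_true_of_mem fun j _ => j.2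
    refine (congrArg (fun s => Fin.ofNat (n + 1) (Finset.card s)) this).trans ?_
    ext
    simp
  | cast i =>
    have : (Finset.univ.filter fun j : Fin (n + 1) => (j : ℕ) < i.castSucc) = Finset.Iio i := by
      ext j
      simp
    refine (congrArg (fun s => Fin.ofNat (n + 1) (Finset.card s)) this).trans ?_
    simp

namespace PreLogHom

variable {X Y : PreLogRing.{u}} (f : PreLogHom X Y)

/-- `C_n((A, M)/(R, P)) = B_{n+1}`, as an `A`-algebra through the tensor factor `0`. -/
def CBar (n : ℕ) : Type u := f.Bar (n + 1)

/-- The ring structure of `B_{n+1}`. -/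
def CBar.commRing (n : ℕ) : CommRing (f.CBar n) := (inferInstance : CommRing (f.Bar (n + 1)))

instance (n : ℕ) : CommRing (f.CBar n) := CBar.commRing f n

instance (n : ℕ) : Algebra Y.Ring (f.CBar n) := (Bar.ι f (n + 1) 0).toAlgebra

/-- The `A`-algebra homomorphism `C_n → C_m` induced by a monotone map `[m] → [n]`. -/
def CBar.map {m n : SimplexCategory} (θ : m ⟶ n) : f.CBar n.len →ₐ[Y.Ring] f.CBar m.len :=
  { Bar.map f (circle θ) with
    commutes' := fun a => (Bar.map_ι f (circle θ) 0 a).trans (by rw [circle_zero]; rfl) }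

/-- The replete cyclic bar construction as a simplicial `A`-module. Its faces are
`a_0 ⊗ ⋯ ⊗ a_n ↦ a_0 ⊗ ⋯ ⊗ a_i a_{i+1} ⊗ ⋯ ⊗ a_n` for `i < n` and
`a_0 ⊗ ⋯ ⊗ a_n ↦ a_n a_0 ⊗ a_1 ⊗ ⋯ ⊗ a_{n-1}` for `i = n`, and likewise on the monoids. -/
def cyclicBar : SimplicialObject (ModuleCat.{u} Y.Ring) where
  obj n := ModuleCat.of Y.Ring (f.CBar n.unop.len)
  map θ := ModuleCat.ofHom (CBar.map f θ.unop).toLinearMap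
  map_id n := by
    ext x
    have h : Bar.map f (circle (𝟙 n.unop)) = RingHom.id _ := by rw [circle_id, Bar.map_id]
    exact RingHom.congr_fun h x
  map_comp θ ψ := by
    ext x
    have h : Bar.map f (circle (ψ.unop ≫ θ.unop)) =
        (Bar.map f (circle ψ.unop)).comp (Bar.map f (circle θ.unop)) := by
      rw [circle_comp, Bar.map_comp]
    exact RingHom.congr_fun h x

/-- The complex `C((A, M)/(R, P))` with the Hochschild differential `∑ (-1)^i d_i`. -/
def cyclicBarComplex : ChainComplex (ModuleCat.{u} Y.Ring) ℕ :=
  (AlgebraicTopology.alternatingFaceMapComplex _).obj f.cyclicBar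

end PreLogHom

/-! ### Log Hochschild homology -/

instance {S A : Type u} [CommRing S] [CommRing A] (φ : S →+* A) :
    (ModuleCat.extendScalars.{u, u, u} φ).Additive :=
  (ModuleCat.extendRestrictScalarsAdj φ).left_adjoint_additive

/-- A chain complex in degrees `≥ 0` as an object of the derived category. -/
def toDerived {A : Type u} [CommRing A] [HasDerivedCategory.{w} (ModuleCat.{u} A)]
    (K : ChainComplex (ModuleCat.{u} A) ℕ) : DerivedCategory (ModuleCat.{u} A) :=
  DerivedCategory.Q.obj (K.extend ComplexShape.embeddingDownNat)

/-- The derived tensor product `A ⊗^L_S N` in the derived category of `A`-modules, for a ring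
homomorphism `S → A` and an `S`-module `N`: apply `A ⊗_S -` to a projective resolution of `N`. -/
def derivedTensor {S A : Type u} [CommRing S] [CommRing A] (φ : S →+* A)
    [HasDerivedCategory.{w} (ModuleCat.{u} A)] (N : ModuleCat.{u} S) :
    DerivedCategory (ModuleCat.{u} A) :=
  toDerived (((ModuleCat.extendScalars.{u, u, u} φ).mapHomologicalComplex (ComplexShape.down ℕ)).obj
    (projectiveResolution N).complex)

namespace PreLogHom

variable {X Y : PreLogRing.{u}} (f : PreLogHom X Y)

/-- Log Hochschild homology `A ⊗^L_{B_2} A` of `(R, P) → (A, M)`, where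
`B_2 = (A ⊗_R A) ⊗_{ℤ[M ⊕_P M]} ℤ[(M ⊕_P M)^rep]` acts on `A` by the augmentation. -/
def logHH [HasDerivedCategory.{w} (ModuleCat.{u} Y.Ring)] :
    DerivedCategory (ModuleCat.{u} Y.Ring) :=
  derivedTensor (Bar.fold f 2)
    ((ModuleCat.restrictScalars (Bar.fold f 2)).obj (ModuleCat.of Y.Ring Y.Ring))

/-- For splittings `P = P₁ ⊕ P₂`, `M = M₁ ⊕ M₂` with `P → M` the sum of `P₁ → M₁` and `P₂ → M₂`,
the induced ring homomorphism `R ⊗_{ℤ[P₁]} ℤ[M₁] → A`. -/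
def chartMap {P₁ P₂ M₁ M₂ : Type u} [CommMonoid P₁] [CommMonoid P₂] [CommMonoid M₁]
    [CommMonoid M₂] (eP : P₁ × P₂ ≃* X.Mon) (eM : M₁ × M₂ ≃* Y.Mon)
    (φ₁ : P₁ →* M₁) (φ₂ : P₂ →* M₂)
    (hφ : ∀ p : P₁ × P₂, f.mon (eP p) = eM (φ₁ p.1, φ₂ p.2)) :
    RingPushout
      (monoidRingLift (X.α.comp (eP.toMonoidHom.comp (MonoidHom.inl P₁ P₂))))
      (monoidRingMap φ₁) →+* Y.Ring :=
  RingPushout.lift f.ring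
    (monoidRingLift (Y.α.comp (eM.toMonoidHom.comp (MonoidHom.inl M₁ M₂))))
    (monoidRing_hom_ext fun p => by
      have h : f.mon (eP (p, 1)) = eM (φ₁ p, 1) := by simpa using hφ (p, 1)
      simp [monoidRingLift, ← f.comm, h])

end PreLogHom

end LogHH

end

/-! The argument is the replete form of the classical computation of Hochschild homology by the bar
resolution. All maps between the rings `B_n` come from a universal property (`Bar.lift`,
`Bar.hom_ext`): a ring map `B_n → T` amounts to ring maps `g_i : A → T` that agree on `R`, together
with unit-valued characters of `M`, trivial on `P`, that measure the ratios of the values of the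
`g_i` on `α(M)`. Hence `B_n` depends functorially on a finite set of positions, and gluing finite
sets produces pushouts of rings.

Put the positions on the simplicial interval. This gives the simplicial ring `n ↦ B_{n+2}`, an
algebra over `B_2` through the two end points. Adding a new first position is an extra degeneracy
(`barD_map_succ`), so the associated complex is a resolution of `A` over `B_2`. Base change along
the augmentation `B_2 → A` glues the end points, turns the interval into the circle, and so turns
`B_{n+2}` into `B_{n+1}` (`isIso_extendGlueHom`, `glue_comp_interval`): the result is the cyclic bar
complex.

It remains to see that the resolution is flat and that flat resolutions compute the derived tensor
product. The second point holds because an acyclic bounded above complex of flat modules stays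
acyclic after base change; this is applied to the mapping cone of a comparison map. For the first,
`B_{k+1} = B_k ⊗_A B_2`, so `B_{n+2}` is flat over `B_2` as soon as `A → B_2` is flat
(`flat_map_ends`).

The chart gives this last flatness (`flat_ι_zero`). With `G = M₁^gp / P₁^gp`, the ring `B_2` is the
pushout of `A[G]` and `A` over `R ⊗_{ℤ[P₁]} ℤ[M₁]`. The group `M₂` contributes nothing, since `α`
sends it to units and its ratios are therefore already determined by the two maps from `A`. So `A →
B_2` is the free extension `A → A[G]` followed by a base change of the chart map. -/

noncomputable section

/-! ### Flat modules and exactness of tensor products -/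

namespace Module.Flat

variable {S : Type*} [CommRing S] {K M N L : Type*} [AddCommGroup K] [Module S K]
  [AddCommGroup M] [Module S M] [AddCommGroup N] [Module S N] [AddCommGroup L] [Module S L]

/-- For an ideal `I`, the map `I ⊗ K → I ⊗ M` is injective because `N` is flat, and `I ⊗ M → S ⊗ M`
is injective because `M` is flat. The composite factors through `I ⊗ K → S ⊗ K`, which is therefore
injective. -/
theorem of_shortExact [Module.Flat S M] [Module.Flat S N] (f : K →ₗ[S] M) (g : M →ₗ[S] N)
    (hf : Function.Injective f) (hg : Function.Surjective g) (hfg : Function.Exact f g) :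
    Module.Flat S K := by
  rw [Module.Flat.iff_rTensor_injective']
  intro I
  have h1 : Function.Injective (f.lTensor I) :=
    LinearMap.lTensor_injective_of_exact_of_flat g hg f hf hfg I
  have h2 : Function.Injective (LinearMap.rTensor M I.subtype) :=
    Module.Flat.rTensor_preserves_injective_linearMap _ I.injective_subtype
  have h3 : (LinearMap.lTensor S f) ∘ₗ (LinearMap.rTensor K I.subtype) =
      (LinearMap.rTensor M I.subtype) ∘ₗ (f.lTensor I) := by
    ext; simp
  refine Function.Injective.of_comp (f := LinearMap.lTensor S f) ?_
  rw [← LinearMap.coe_comp, h3, LinearMap.coe_comp]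
  exact h2.comp h1

theorem prod [Module.Flat S M] [Module.Flat S N] : Module.Flat S (M × N) := by
  rw [Module.Flat.iff_rTensor_injective']
  intro I
  have h1 := Module.Flat.rTensor_preserves_injective_linearMap (M := M) _ I.injective_subtype
  have h2 := Module.Flat.rTensor_preserves_injective_linearMap (M := N) _ I.injective_subtype
  have h3 : (TensorProduct.prodRight S S S M N).toLinearMap ∘ₗ
      LinearMap.rTensor (M × N) I.subtype =
      (LinearMap.prodMap (LinearMap.rTensor M I.subtype) (LinearMap.rTensor N I.subtype)) ∘ₗ
        (TensorProduct.prodRight S S I M N).toLinearMap := by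
    ext <;> simp
  refine Function.Injective.of_comp (f := (TensorProduct.prodRight S S S M N).toLinearMap) ?_
  rw [← LinearMap.coe_comp, h3, LinearMap.coe_comp, LinearMap.coe_prodMap]
  exact (h1.prodMap h2).comp (TensorProduct.prodRight S S I M N).injective

/-- If `K → M → N → L` is exact and the image of `N → L` is flat, then `A ⊗ K → A ⊗ M → A ⊗ N` is
exact. -/
theorem lTensor_exact_of_flat_range (A : Type*) [AddCommGroup A] [Module S A]
    (f : K →ₗ[S] M) (g : M →ₗ[S] N) (h : N →ₗ[S] L)
    (hfg : Function.Exact f g) (hgh : Function.Exact g h) [Module.Flat S (LinearMap.range h)] :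
    Function.Exact (f.lTensor A) (g.lTensor A) := by
  let g' : M →ₗ[S] LinearMap.ker h := g.codRestrict _ hgh.apply_apply_eq_zero
  have hg' : Function.Surjective g' := by
    rintro ⟨y, hy⟩
    obtain ⟨x, rfl⟩ := (hgh y).mp hy
    exact ⟨x, rfl⟩
  have hfg' : Function.Exact f g' := fun x => by
    rw [← hfg x, Subtype.ext_iff]; rfl
  have h1 := _root_.lTensor_exact A hfg' hg'
  -- Flatness of the quotient `range h` of `N` keeps the inclusion of `ker h` injective after
  -- tensoring.
  have h2 : Function.Injective ((LinearMap.ker h).subtype.lTensor A) :=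
    LinearMap.lTensor_injective_of_exact_of_flat h.rangeRestrict h.surjective_rangeRestrict _
      (LinearMap.ker h).injective_subtype
      (fun x => by simp [LinearMap.rangeRestrict, Subtype.ext_iff]) A
  have h3 : g.lTensor A = ((LinearMap.ker h).subtype.lTensor A) ∘ₗ (g'.lTensor A) := by
    rw [← LinearMap.lTensor_comp]; rfl
  intro x
  rw [← h1 x, h3, LinearMap.comp_apply]
  exact map_eq_zero_iff _ h2

end Module.Flat

/-! ### Acyclic complexes of flat modules -/

namespace CochainComplex

open HomologicalComplex

variable {S A : Type u} [CommRing S] [CommRing A]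

theorem exactAt_iff_exact (K : CochainComplex (ModuleCat.{u} S) ℤ) (i : ℤ) :
    K.ExactAt i ↔ Function.Exact (K.d (i - 1) i).hom (K.d i (i + 1)).hom := by
  rw [K.exactAt_iff' (i - 1) i (i + 1) (by simp) (by simp),
    ShortComplex.ShortExact.moduleCat_exact_iff_function_exact]
  rfl

/-- Descending induction on the degree, starting above the bound `b`, where the target is zero. By
acyclicity the image in degree `j` is the kernel of the map from the flat module `K.X j` onto the
next image, which is flat by induction. -/
theorem flat_range_of_acyclic (K : CochainComplex (ModuleCat.{u} S) ℤ) (hK : K.Acyclic)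
    [∀ i, Module.Flat S (K.X i)] (b : ℤ) (hb : ∀ i, b < i → Limits.IsZero (K.X i)) (i j : ℤ)
    (hij : i + 1 = j) : Module.Flat S (LinearMap.range (K.d i j).hom) := by
  have key : ∀ (n : ℕ) (i j : ℤ), i + 1 = j → b < j + n →
      Module.Flat S (LinearMap.range (K.d i j).hom) := by
    intro n
    induction n with
    | zero =>
      intro i j _ h
      have := ModuleCat.isZero_iff_subsingleton.mp (hb j (by simpa using h))
      infer_instance
    | succ n ih =>
      intro i j hij h
      have := ih j (j + 1) rfl (by push_cast at h; omega)
      have hex := (exactAt_iff_exact K j).mp (hK j)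
      obtain rfl : i = j - 1 := by omega
      exact Module.Flat.of_shortExact (LinearMap.range (K.d (j - 1) j).hom).subtype
        (K.d j (j + 1)).hom.rangeRestrict (Submodule.injective_subtype _)
        (LinearMap.surjective_rangeRestrict _)
        (fun x => by
          rw [Subtype.ext_iff, Submodule.coe_subtype, Subtype.range_coe]
          exact hex x)
  exact key (b - j + 1).toNat i j hij (by omega)

theorem acyclic_extendScalars (φ : S →+* A) (K : CochainComplex (ModuleCat.{u} S) ℤ)
    (hK : K.Acyclic) [∀ i, Module.Flat S (K.X i)] (b : ℤ)
    (hb : ∀ i, b < i → Limits.IsZero (K.X i)) :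
    (((ModuleCat.extendScalars.{u, u, u} φ).mapHomologicalComplex _).obj K).Acyclic := by
  intro i
  rw [exactAt_iff_exact]
  let := φ.toAlgebra
  -- Exactness in degree `i` survives because the image of the differential leaving degree `i + 1`
  -- is flat.
  have := flat_range_of_acyclic K hK b hb (i + 1) (i + 1 + 1) rfl
  have h2 : Function.Exact (K.d i (i + 1)).hom (K.d (i + 1) (i + 1 + 1)).hom := by
    have := (K.exactAt_iff' i (i + 1) (i + 1 + 1) (by simp) (by simp)).mp (hK (i + 1))
    rwa [ShortComplex.ShortExact.moduleCat_exact_iff_function_exact] at this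
  exact Module.Flat.lTensor_exact_of_flat_range A _ _ _ ((exactAt_iff_exact K i).mp (hK i)) h2

/-- In the homotopy category the quasi-isomorphisms are the morphisms whose cone lies in the
triangulated subcategory of acyclic complexes. -/
theorem quasiIso_iff_mappingCone_acyclic {C : Type*} [Category C] [Abelian C]
    {K L : CochainComplex C ℤ} (φ : K ⟶ L) : QuasiIso φ ↔ (mappingCone φ).Acyclic := by
  rw [← HomologicalComplex.mem_quasiIso_iff,
    ← HomotopyCategory.quotient_map_mem_quasiIso_iff,
    HomotopyCategory.quasiIso_eq_trW_subcategoryAcyclic]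
  refine ((HomotopyCategory.subcategoryAcyclic C).trW_iff_of_distinguished
    (mappingCone.triangleh φ) (HomotopyCategory.mappingCone_triangleh_distinguished φ)).trans ?_
  exact HomotopyCategory.quotient_obj_mem_subcategoryAcyclic_iff_acyclic _

/-- The cone of `g` is `K.X (i + 1) ⊞ L.X i` in degree `i`, hence flat and bounded above, so its
acyclicity is preserved. Additive functors commute with cones. -/
theorem quasiIso_extendScalars (φ : S →+* A) {K L : CochainComplex (ModuleCat.{u} S) ℤ}
    (g : K ⟶ L) [QuasiIso g] [∀ i, Module.Flat S (K.X i)] [∀ i, Module.Flat S (L.X i)] (b : ℤ)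
    (hK : ∀ i, b < i → Limits.IsZero (K.X i)) (hL : ∀ i, b < i → Limits.IsZero (L.X i)) :
    QuasiIso (((ModuleCat.extendScalars.{u, u, u} φ).mapHomologicalComplex _).map g) := by
  rw [quasiIso_iff_mappingCone_acyclic]
  let e (i : ℤ) : (mappingCone g).X i ≅ K.X (i + 1) ⊞ L.X i :=
    homotopyCofiber.XIsoBiprod g i (i + 1) rfl
  have hflat (i : ℤ) : Module.Flat S ((mappingCone g).X i) :=
    have : Module.Flat S (K.X (i + 1) × L.X i) := .prod
    Module.Flat.of_linearEquiv (e i ≪≫ ModuleCat.biprodIsoProd _ _).toLinearEquiv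
  have hz (i : ℤ) (hi : b < i) : Limits.IsZero ((mappingCone g).X i) :=
    ((Limits.biprod_isZero_iff _ _).mpr ⟨hK _ (by omega), hL _ hi⟩).of_iso (e i)
  have h := acyclic_extendScalars φ (mappingCone g)
    ((quasiIso_iff_mappingCone_acyclic g).mp ‹_›) b hz
  exact fun i => (h i).of_iso (mappingCone.mapHomologicalComplexIso g (ModuleCat.extendScalars.{u, u, u} φ))

end CochainComplex

/-! ### Extension of complexes and additive functors -/

namespace HomologicalComplex

open Limits

variable {ι ι' : Type*} {c : ComplexShape ι} {c' : ComplexShape ι'}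
  {C D : Type*} [Category C] [Category D] [HasZeroObject C] [HasZeroObject D]
  [Preadditive C] [Preadditive D]

/-- A functor that preserves zero commutes in each degree with the extension of complexes. -/
def extend.mapXIso (F : C ⥤ D) [F.Additive] (K : HomologicalComplex C c) :
    ∀ i : Option ι, F.obj (extend.X K i) ≅ extend.X ((F.mapHomologicalComplex c).obj K) i
  | some _ => Iso.refl _
  | none => F.mapZeroObject

theorem extend.mapXIso_hom_d (F : C ⥤ D) [F.Additive] (K : HomologicalComplex C c) :
    ∀ i j : Option ι, (extend.mapXIso F K i).hom ≫
      extend.d ((F.mapHomologicalComplex c).obj K) i j =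
        F.map (extend.d K i j) ≫ (extend.mapXIso F K j).hom
  | none, j => by
    rw [extend.d_none_eq_zero _ _ _ rfl, extend.d_none_eq_zero _ _ _ rfl]; simp
  | some i, none => by
    rw [extend.d_none_eq_zero' _ _ _ rfl, extend.d_none_eq_zero' _ _ _ rfl]; simp
  | some i, some j => (Category.id_comp _).trans (Category.comp_id _).symm

/-- Additive functors commute with the extension of complexes. -/
def extendMapIso (F : C ⥤ D) [F.Additive] (e : c.Embedding c') (K : HomologicalComplex C c) :
    (F.mapHomologicalComplex c').obj (K.extend e) ≅
      ((F.mapHomologicalComplex c).obj K).extend e :=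
  Hom.isoOfComponents (fun i => extend.mapXIso F K (e.r i))
    (fun i j _ => extend.mapXIso_hom_d F K (e.r i) (e.r j))

theorem extendMapIso_hom_naturality (F : C ⥤ D) [F.Additive] (e : c.Embedding c')
    {K L : HomologicalComplex C c} (g : K ⟶ L) :
    (F.mapHomologicalComplex c').map (extendMap g e) ≫ (extendMapIso F e L).hom =
      (extendMapIso F e K).hom ≫ extendMap ((F.mapHomologicalComplex c).map g) e := by
  have key : ∀ i : Option ι, F.map (extend.mapX g i) ≫ (extend.mapXIso F L i).hom =
      (extend.mapXIso F K i).hom ≫ extend.mapX ((F.mapHomologicalComplex c).map g) i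
    | some i => (Category.comp_id _).trans (Category.id_comp _).symm
    | none => by
      rw [extend.mapX_none g rfl, extend.mapX_none _ rfl]; simp
  ext i
  exact key (e.r i)

end HomologicalComplex

namespace ChainComplex

open HomologicalComplex

variable {S A : Type u} [CommRing S] [CommRing A]

theorem quasiIso_extendScalars (φ : S →+* A) {K L : ChainComplex (ModuleCat.{u} S) ℕ}
    (g : K ⟶ L) [QuasiIso g] [∀ i, Module.Flat S (K.X i)] [∀ i, Module.Flat S (L.X i)] :
    QuasiIso (((ModuleCat.extendScalars.{u, u, u} φ).mapHomologicalComplex _).map g) := by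
  have hz (M : ChainComplex (ModuleCat.{u} S) ℕ) (i : ℤ) (hi : 0 < i) :
      Limits.IsZero ((M.extend ComplexShape.embeddingDownNat).X i) :=
    M.isZero_extend_X _ _ (fun n hn => by
      have : -(n : ℤ) = i := hn
      omega)
  have hflat (M : ChainComplex (ModuleCat.{u} S) ℕ) [∀ i, Module.Flat S (M.X i)] (i : ℤ) :
      Module.Flat S ((M.extend ComplexShape.embeddingDownNat).X i) := by
    by_cases hi : 0 < i
    · have := ModuleCat.isZero_iff_subsingleton.mp (hz M i hi)
      infer_instance
    · exact Module.Flat.of_linearEquiv (M.extendXIso ComplexShape.embeddingDownNat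
        (i := (-i).toNat) (i' := i) (by
          change -((-i).toNat : ℤ) = i
          omega)).toLinearEquiv
  have h := CochainComplex.quasiIso_extendScalars φ
    (extendMap g ComplexShape.embeddingDownNat) 0 (hz K) (hz L)
  have e := extendMapIso_hom_naturality (ModuleCat.extendScalars.{u, u, u} φ)
    ComplexShape.embeddingDownNat g
  rw [← quasiIso_extendMap_iff _ ComplexShape.embeddingDownNat]
  rw [← quasiIso_iff_comp_left (extendMapIso (ModuleCat.extendScalars.{u, u, u} φ)
    ComplexShape.embeddingDownNat K).hom, ← e]
  infer_instance

end ChainComplex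

/-! ### Derived tensor products from flat resolutions -/

namespace CategoryTheory.ProjectiveResolution

variable {C : Type*} [Category C] [Abelian C] {Z : C}

/-- A chain map from a projective resolution to an exact augmented complex. -/
theorem exists_lift_of_exact (P : ProjectiveResolution Z) (K : ChainComplex C ℕ) (ε : K.X 0 ⟶ Z)
    (hε : K.d 1 0 ≫ ε = 0) (hepi : Epi ε) (h0 : (ShortComplex.mk _ _ hε).Exact)
    (hK : ∀ n, (ShortComplex.mk _ _ (K.d_comp_d (n + 2) (n + 1) n)).Exact) :
    ∃ g : P.complex ⟶ K, g.f 0 ≫ ε = P.π.f 0 := by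
  let p : P.complex.X 0 ⟶ Z := P.π.f 0
  let f0 : P.complex.X 0 ⟶ K.X 0 := Projective.factorThru p ε
  have hf0 : f0 ≫ ε = P.π.f 0 := Projective.factorThru_comp _ _
  -- The first two components are built by hand, since exactness at `K.X 0` involves `ε`; the later
  -- ones come by induction from exactness of `K`.
  let f1 : P.complex.X 1 ⟶ K.X 1 :=
    h0.liftFromProjective (P.complex.d 1 0 ≫ f0)
      (((Category.assoc _ _ _).trans (congrArg _ hf0)).trans P.complex_d_comp_π_f_zero)
  have hf1 : f1 ≫ K.d 1 0 = P.complex.d 1 0 ≫ f0 := h0.liftFromProjective_comp _ _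
  refine ⟨ChainComplex.mkHom _ _ f0 f1 hf1 (fun n ⟨g, g', w⟩ =>
    ⟨(hK n).liftFromProjective (P.complex.d (n + 2) (n + 1) ≫ g') (by simp [w]),
      (hK n).liftFromProjective_comp _ _⟩), ?_⟩
  simpa using hf0

end CategoryTheory.ProjectiveResolution

namespace ChainComplex

variable {C : Type*} [Category C] [Abelian C] {Z : C}

/-- In degree zero this is right exactness of `K.X 1 → K.X 0 → Z → 0`; in positive degrees the
target is acyclic and the claim is exactness of `K`. -/
theorem quasiIso_toSingle₀ (K : ChainComplex C ℕ) (ε : K.X 0 ⟶ Z)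
    (hε : K.d 1 0 ≫ ε = 0) (hepi : Epi ε) (h0 : (ShortComplex.mk _ _ hε).Exact)
    (hK : ∀ n, (ShortComplex.mk _ _ (K.d_comp_d (n + 2) (n + 1) n)).Exact) :
    QuasiIso ((toSingle₀Equiv K Z).symm ⟨ε, hε⟩) := by
  refine ⟨fun n => ?_⟩
  cases n
  · rw [ChainComplex.quasiIsoAt₀_iff, ShortComplex.quasiIso_iff_of_zeros']
    · refine (ShortComplex.exact_and_epi_g_iff_of_iso ?_).2 ⟨h0, hepi⟩
      exact ShortComplex.isoMk (Iso.refl _) (Iso.refl _) (Iso.refl _)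
        ((Category.id_comp _).trans (Category.comp_id _).symm)
        ((Category.id_comp _).trans ((Category.comp_id _).trans (by simp)).symm)
    · exact K.shape _ _ (by simp)
    all_goals rfl
  · rename_i n
    rw [quasiIsoAt_iff_exactAt']
    · rw [HomologicalComplex.exactAt_iff' _ (n + 1 + 1) (n + 1) n (by simp) (by simp)]
      exact hK n
    · apply ChainComplex.exactAt_succ_single_obj

end ChainComplex

namespace LogHH

variable {S A : Type u} [CommRing S] [CommRing A]

/-- The derived tensor product can be computed by a flat resolution. -/
theorem nonempty_derivedTensor_iso (φ : S →+* A) [HasDerivedCategory.{w} (ModuleCat.{u} A)]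
    (N : ModuleCat.{u} S) (K : ChainComplex (ModuleCat.{u} S) ℕ) [∀ i, Module.Flat S (K.X i)]
    (ε : K.X 0 ⟶ N) (hε : K.d 1 0 ≫ ε = 0) (hepi : Epi ε) (h0 : (ShortComplex.mk _ _ hε).Exact)
    (hK : ∀ n, (ShortComplex.mk _ _ (K.d_comp_d (n + 2) (n + 1) n)).Exact) :
    Nonempty (derivedTensor φ N ≅ toDerived
      (((ModuleCat.extendScalars.{u, u, u} φ).mapHomologicalComplex _).obj K)) := by
  obtain ⟨g, hg⟩ := (projectiveResolution N).exists_lift_of_exact K ε hε hepi h0 hK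
  have h1 : QuasiIso ((ChainComplex.toSingle₀Equiv K N).symm ⟨ε, hε⟩) :=
    K.quasiIso_toSingle₀ ε hε hepi h0 hK
  have h2 : g ≫ (ChainComplex.toSingle₀Equiv K N).symm ⟨ε, hε⟩ = (projectiveResolution N).π := by
    refine HomologicalComplex.to_single_hom_ext ?_
    simpa using hg
  have h3 : QuasiIso (g ≫ (ChainComplex.toSingle₀Equiv K N).symm ⟨ε, hε⟩) := by
    rw [h2]; infer_instance
  -- The comparison map lies over `N`, so two-out-of-three applies to the two resolutions.
  have h4 : QuasiIso g := quasiIso_of_comp_right g ((ChainComplex.toSingle₀Equiv K N).symm ⟨ε, hε⟩)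
  have h5 (i : ℕ) : Module.Flat S ((projectiveResolution N).complex.X i) := by
    have : Module.Projective S ((projectiveResolution N).complex.X i) :=
      (IsProjective.iff_projective _).mpr ((projectiveResolution N).projective i)
    infer_instance
  have h6 := ChainComplex.quasiIso_extendScalars φ g
  have h7 : IsIso (DerivedCategory.Q.map (HomologicalComplex.extendMap
      (((ModuleCat.extendScalars.{u, u, u} φ).mapHomologicalComplex _).map g)
        ComplexShape.embeddingDownNat)) := by
    rw [DerivedCategory.isIso_Q_map_iff_quasiIso]
    infer_instance
  exact ⟨@asIso _ _ _ _ _ h7⟩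

end LogHH

/-! ### Universal properties of repletions and of `B_n` -/

namespace LogHH

section Monoids

variable {P M : Type u} [CommMonoid P] [CommMonoid M] {φ : P →* M} {n : ℕ}

@[simp]
theorem Amalg.fold_ι (i : Fin n) (m : M) : Amalg.fold φ n (Amalg.ι φ n i m) = m :=
  Amalg.lift_ι _ _ _ _ _

@[simp]
theorem Amalg.map_ι {k l : ℕ} (c : Fin k → Fin l) (i : Fin k) (m : M) :
    Amalg.map φ c (Amalg.ι φ k i m) = Amalg.ι φ l (c i) m :=
  Amalg.lift_ι _ _ _ _ _

theorem gpMap_fold_gpMap_ι (i : Fin n) (x : Algebra.GrothendieckGroup M) :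
    gpMap (Amalg.fold φ n) (gpMap (Amalg.ι φ n i) x) = x := by
  have h : (Amalg.fold φ n).comp (Amalg.ι φ n i) = MonoidHom.id M := MonoidHom.ext fun m =>
    Amalg.fold_ι i m
  have := gpMap_comp (Amalg.ι φ n i) (Amalg.fold φ n)
  rw [h, gpMap_id] at this
  exact DFunLike.congr_fun this x

namespace RepAmalg

variable (φ n) in
/-- The homomorphism `y ↦ (1, y / ι_i (fold y))` from the group completion of `⊕_P^n M` to its
repletion. -/
def ofGp (i : Fin n) : Algebra.GrothendieckGroup (Amalg φ n) →* RepAmalg φ n :=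
  ((1 : Algebra.GrothendieckGroup (Amalg φ n) →* M).prod
    (MonoidHom.id _ / (gpMap (Amalg.ι φ n i)).comp (gpMap (Amalg.fold φ n)))).codRestrict
      (repletion (Amalg.fold φ n)) (fun y => by
        change Algebra.GrothendieckGroup.of 1 = gpMap (Amalg.fold φ n)
          (y / gpMap (Amalg.ι φ n i) (gpMap (Amalg.fold φ n) y))
        rw [map_one, map_div, gpMap_fold_gpMap_ι, div_self'])

variable (φ n) in
/-- The unit `(1, ι_j m / ι_i m)` of the repletion. -/
def ratio (i j : Fin n) : M →* (RepAmalg φ n)ˣ :=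
  (ofGp φ n i).toHomUnits.comp (Algebra.GrothendieckGroup.of.comp (Amalg.ι φ n j))

theorem ratio_fst (i j : Fin n) (m : M) : (ratio φ n i j m : RepAmalg φ n).1.1 = 1 := rfl

theorem ratio_snd (i j : Fin n) (m : M) : (ratio φ n i j m : RepAmalg φ n).1.2 =
    Algebra.GrothendieckGroup.of (Amalg.ι φ n j m) /
      Algebra.GrothendieckGroup.of (Amalg.ι φ n i m) := by
  change Algebra.GrothendieckGroup.of (Amalg.ι φ n j m) / gpMap (Amalg.ι φ n i)
    (gpMap (Amalg.fold φ n) (Algebra.GrothendieckGroup.of (Amalg.ι φ n j m))) = _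
  rw [gpMap_of, gpMap_of, Amalg.fold_ι]

theorem ratio_mul_ratio (i j k : Fin n) (m : M) :
    ratio φ n i j m * ratio φ n j k m = ratio φ n i k m := by
  refine Units.ext (Subtype.ext (Prod.ext ?_ ?_))
  · rw [Units.val_mul, Submonoid.coe_mul, Prod.fst_mul, ratio_fst, ratio_fst, ratio_fst, mul_one]
  · rw [Units.val_mul, Submonoid.coe_mul, Prod.snd_mul, ratio_snd, ratio_snd, ratio_snd, mul_comm,
      div_mul_div_cancel]

theorem ratio_base (i j : Fin n) (p : P) : ratio φ n i j (φ p) = 1 := by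
  refine Units.ext (Subtype.ext (Prod.ext rfl ?_))
  rw [ratio_snd]
  have h (k : Fin n) : Amalg.ι φ n k (φ p) = Amalg.base φ n p :=
    DFunLike.congr_fun (Amalg.ι_comp k) p
  rw [h, h, div_self']
  rfl

theorem map_ratio {k l : ℕ} (c : Fin k → Fin l) (i j : Fin k) (m : M) :
    RepAmalg.map φ c (ratio φ k i j m) = ratio φ l (c i) (c j) m := by
  refine Subtype.ext (Prod.ext rfl ?_)
  rw [ratio_snd]
  change gpMap (Amalg.map φ c) ((ratio φ k i j m : RepAmalg φ k).1.2) = _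
  rw [ratio_snd, map_div, gpMap_of, gpMap_of, Amalg.map_ι, Amalg.map_ι]

theorem toRepletion_ι (i j : Fin n) (m : M) :
    toRepletion (Amalg.fold φ n) (Amalg.ι φ n j m) =
      toRepletion (Amalg.fold φ n) (Amalg.ι φ n i m) * ratio φ n i j m := by
  refine Subtype.ext (Prod.ext ?_ ?_)
  · change Amalg.fold φ n _ = Amalg.fold φ n _ * 1
    simp
  · change Algebra.GrothendieckGroup.of _ = Algebra.GrothendieckGroup.of _ *
      ((ratio φ n i j m : RepAmalg φ n).1.2)
    rw [ratio_snd, mul_div_cancel]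

/-- An element `(m, y)` of the repletion is the product of `ι_i m` and `(1, y / ι_i m)`. The second
factor lies in the image of the group `(⊕_P^n M)^gp` under `ofGp`, which is generated by the ratios
with base `i`. -/
theorem hom_ext {T : Type*} [CommMonoid T] {v v' : RepAmalg φ n →* T} (i : Fin n)
    (hι : ∀ m, v (toRepletion (Amalg.fold φ n) (Amalg.ι φ n i m)) =
      v' (toRepletion (Amalg.fold φ n) (Amalg.ι φ n i m)))
    (hratio : ∀ j m, v (ratio φ n i j m) = v' (ratio φ n i j m)) : v = v' := by
  -- A homomorphism out of a group lands in the units, so the universal property of group completion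
  -- applies with target `Tˣ`.
  have key : (v.comp (ofGp φ n i)).toHomUnits = (v'.comp (ofGp φ n i)).toHomUnits := by
    have h (j : Fin n) : ((v.comp (ofGp φ n i)).toHomUnits.comp
          Algebra.GrothendieckGroup.of).comp (Amalg.ι φ n j) =
        ((v'.comp (ofGp φ n i)).toHomUnits.comp
          Algebra.GrothendieckGroup.of).comp (Amalg.ι φ n j) :=
      MonoidHom.ext fun m => Units.ext (hratio j m)
    refine gp_hom_ext (Amalg.hom_ext ?_ h)
    rw [← Amalg.ι_comp i, ← MonoidHom.comp_assoc, ← MonoidHom.comp_assoc, h]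
  refine MonoidHom.ext fun x => ?_
  have hx : x = toRepletion (Amalg.fold φ n) (Amalg.ι φ n i x.1.1) * ofGp φ n i x.1.2 := by
    refine Subtype.ext (Prod.ext ?_ ?_)
    · change x.1.1 = Amalg.fold φ n (Amalg.ι φ n i x.1.1) * 1
      simp
    · change x.1.2 = Algebra.GrothendieckGroup.of (Amalg.ι φ n i x.1.1) *
        (x.1.2 / gpMap (Amalg.ι φ n i) (gpMap (Amalg.fold φ n) x.1.2))
      have h : Algebra.GrothendieckGroup.of x.1.1 = gpMap (Amalg.fold φ n) x.1.2 := x.2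
      rw [← h, gpMap_of, mul_div_cancel]
  rw [hx, map_mul, map_mul, hι]
  exact congrArg _ (congrArg Units.val (DFunLike.congr_fun key x.1.2))

/-- The homomorphism `(m, y) ↦ a m * u y` on the repletion. -/
def lift {T : Type*} [CommMonoid T] (a : M →* T) (u : Fin n → M →* Tˣ)
    (hu : ∀ i p, u i (φ p) = 1) : RepAmalg φ n →* T :=
  (a.coprod ((Units.coeHom T).comp (Algebra.GrothendieckGroup.lift
    (Amalg.lift (φ := φ) 1 u (fun i => MonoidHom.ext (hu i)))))).comp
    (repletion (Amalg.fold φ n)).subtype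

theorem lift_gp_of {T : Type*} [CommGroup T] {N : Type*} [CommMonoid N] (g : N →* T) (m : N) :
    Algebra.GrothendieckGroup.lift g (Algebra.GrothendieckGroup.of m) = g m :=
  DFunLike.congr_fun (Algebra.GrothendieckGroup.lift.symm_apply_apply g) m

variable {T : Type*} [CommMonoid T] (a : M →* T) (u : Fin n → M →* Tˣ)
    (hu : ∀ i p, u i (φ p) = 1)

theorem lift_toRepletion_ι (i : Fin n) (m : M) :
    lift a u hu (toRepletion (Amalg.fold φ n) (Amalg.ι φ n i m)) = a m * u i m := by
  change a (Amalg.fold φ n (Amalg.ι φ n i m)) * ((Algebra.GrothendieckGroup.lift _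
    (Algebra.GrothendieckGroup.of (Amalg.ι φ n i m)) : Tˣ) : T) = _
  rw [lift_gp_of, Amalg.fold_ι, Amalg.lift_ι]

theorem lift_ratio (i j : Fin n) (m : M) :
    lift a u hu (ratio φ n i j m) = ((u j m / u i m : Tˣ) : T) := by
  change a 1 * ((Algebra.GrothendieckGroup.lift _
    ((ratio φ n i j m : RepAmalg φ n).1.2) : Tˣ) : T) = _
  rw [ratio_snd, map_div, lift_gp_of, lift_gp_of, Amalg.lift_ι, Amalg.lift_ι, map_one, one_mul]

end RepAmalg

end Monoids

namespace PreLogHom.Bar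

variable {X Y : PreLogRing.{u}} (f : PreLogHom X Y) {n : ℕ}

variable (n) in
/-- The image in `B_n` of the unit `(1, ι_j m / ι_i m)` of the repletion. -/
def ratio (i j : Fin n) : Y.Mon →* (f.Bar n)ˣ :=
  (Units.map (((RingPushout.inr _ _ : _ →+* f.Bar n) : _ →* f.Bar n).comp
    (MonoidAlgebra.of ℤ (RepAmalg f.mon n)))).comp (RepAmalg.ratio f.mon n i j)

theorem coe_ratio (i j : Fin n) (m : Y.Mon) : (ratio f n i j m : f.Bar n) =
    RingPushout.inr _ _ (MonoidAlgebra.of ℤ (RepAmalg f.mon n) (RepAmalg.ratio f.mon n i j m)) :=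
  rfl

theorem ratio_mul_ratio (i j k : Fin n) (m : Y.Mon) :
    ratio f n i j m * ratio f n j k m = ratio f n i k m := by
  simp only [ratio, MonoidHom.comp_apply, ← map_mul, RepAmalg.ratio_mul_ratio]

theorem ratio_self (i : Fin n) (m : Y.Mon) : ratio f n i i m = 1 := by
  simpa using ratio_mul_ratio f i i i m

theorem ratio_mon (i j : Fin n) (p : X.Mon) : ratio f n i j (f.mon p) = 1 := by
  simp only [ratio, MonoidHom.comp_apply, RepAmalg.ratio_base, map_one]

theorem inr_toRepletion_ι (i : Fin n) (m : Y.Mon) :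
    (RingPushout.inr _ _ (MonoidAlgebra.of ℤ (RepAmalg f.mon n)
      (toRepletion (Amalg.fold f.mon n) (Amalg.ι f.mon n i m))) : f.Bar n) = ι f n i (Y.α m) := by
  have h := RingHom.congr_fun (RingPushout.inl_comp (g := monoidRingLift (f.amalgToTPow n))
    (h := monoidRingMap (toRepletion (Amalg.fold f.mon n))))
    (MonoidAlgebra.of ℤ _ (Amalg.ι f.mon n i m))
  rw [RingHom.comp_apply, RingHom.comp_apply, monoidRingLift_of] at h
  refine Eq.trans ?_ (h.symm.trans ?_)
  · simp
  · exact congrArg (RingPushout.inl _ _) (Amalg.lift_ι _ _ _ i m)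

/-- The tensor product over the monoid ring identifies `ι_i m` in the repletion with `α m` in the
`i`-th tensor factor, and in the repletion `ι_j m` and `ι_i m` differ by a unit. -/
theorem ι_α (i j : Fin n) (m : Y.Mon) :
    ι f n j (Y.α m) = ι f n i (Y.α m) * ratio f n i j m := by
  rw [← inr_toRepletion_ι, ← inr_toRepletion_ι, coe_ratio, RepAmalg.toRepletion_ι i j, map_mul,
    map_mul]

theorem ι_ring (i j : Fin n) (r : X.Ring) : ι f n i (f.ring r) = ι f n j (f.ring r) :=
  congrArg (RingPushout.inl _ _) ((RingHom.congr_fun (TPow.ι_comp i) r).trans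
    (RingHom.congr_fun (TPow.ι_comp j) r).symm)

@[simp]
theorem map_ratio {k l : ℕ} (c : Fin k → Fin l) (i j : Fin k) (m : Y.Mon) :
    map f c (ratio f k i j m) = ratio f l (c i) (c j) m := by
  rw [coe_ratio, coe_ratio, ← RepAmalg.map_ratio]
  simp [map]

theorem fold_ι (i : Fin n) (a : Y.Ring) : fold f n (ι f n i a) = a := by
  simp [fold, ι, TPow.fold]

theorem fold_ratio (i j : Fin n) (m : Y.Mon) : fold f n (ratio f n i j m) = 1 := by
  rw [coe_ratio, fold, RingPushout.lift_inr, monoidRingLift_of]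
  change Y.α ((RepAmalg.ratio f.mon n i j m : RepAmalg f.mon n).1.1) = 1
  rw [RepAmalg.ratio_fst, map_one]

variable {f}

/-- The tensor factors generate the tensor power. The repletion is generated by its `i`-th copy of
`M`, which comes from the `i`-th tensor factor, and by the ratios with base `i`. -/
theorem hom_ext {T : Type u} [CommRing T] {p q : f.Bar n →+* T} (i : Fin n)
    (hι : ∀ j a, p (ι f n j a) = q (ι f n j a))
    (hratio : ∀ j m, p (ratio f n i j m) = q (ratio f n i j m)) : p = q := by
  refine RingPushout.hom_ext (TPow.hom_ext ?_ fun j => RingHom.ext (hι j))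
    (monoidRing_hom_ext fun x => ?_)
  · rw [← TPow.ι_comp i]
    exact RingHom.ext fun r => hι i _
  · refine DFunLike.congr_fun (RepAmalg.hom_ext
      (v := ((p.comp (RingPushout.inr _ _)) : _ →* T).comp (MonoidAlgebra.of ℤ _))
      (v' := ((q.comp (RingPushout.inr _ _)) : _ →* T).comp (MonoidAlgebra.of ℤ _)) i
      (fun m => ?_) (fun j m => hratio j m)) x
    change p (RingPushout.inr _ _ _) = q (RingPushout.inr _ _ _)
    rw [inr_toRepletion_ι, hι]

/-- The ring homomorphism `B_n → T` given by ring homomorphisms `g i : A → T` that agree on `R` and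
by homomorphisms `u i : M → Tˣ` trivial on `P` with `g i (α m) = g i₀ (α m) * u i m`. -/
def lift {T : Type u} [CommRing T] (i₀ : Fin n) (g : Fin n → Y.Ring →+* T)
    (u : Fin n → Y.Mon →* Tˣ) (hg : ∀ i r, g i (f.ring r) = g i₀ (f.ring r))
    (hu : ∀ i p, u i (f.mon p) = 1) (hα : ∀ i m, g i (Y.α m) = g i₀ (Y.α m) * u i m) :
    f.Bar n →+* T :=
  RingPushout.lift (TPow.lift ((g i₀).comp f.ring) g fun i => RingHom.ext (hg i))
    (monoidRingLift (RepAmalg.lift ((g i₀ : Y.Ring →* T).comp Y.α) u hu)) (by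
      refine monoidRing_hom_ext fun x => ?_
      rw [RingHom.comp_apply, RingHom.comp_apply, monoidRingLift_of]
      -- The two maps out of the amalgamated sum need only be compared on each copy of `M`, where
      -- the equality is `hα j`; on `P` it follows by restricting the copy `i₀`.
      have h (j : Fin n) : (((TPow.lift ((g i₀).comp f.ring) g fun i => RingHom.ext (hg i) :
            f.TPow n →+* T) : f.TPow n →* T).comp (f.amalgToTPow n)).comp (Amalg.ι f.mon n j) =
          ((RepAmalg.lift ((g i₀ : Y.Ring →* T).comp Y.α) u hu).comp
            (toRepletion (Amalg.fold f.mon n))).comp (Amalg.ι f.mon n j) := by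
        refine MonoidHom.ext fun m => ?_
        have := RepAmalg.lift_toRepletion_ι ((g i₀ : Y.Ring →* T).comp Y.α) u hu j m
        refine Eq.trans ?_ this.symm
        simp [amalgToTPow, hα j]
      have key := Amalg.hom_ext (by
        rw [← Amalg.ι_comp i₀, ← MonoidHom.comp_assoc, ← MonoidHom.comp_assoc, h]) h
      refine (DFunLike.congr_fun key x).trans ?_
      simp [monoidRingLift])

section lift

variable {T : Type u} [CommRing T] (i₀ : Fin n) (g : Fin n → Y.Ring →+* T)
    (u : Fin n → Y.Mon →* Tˣ) (hg : ∀ i r, g i (f.ring r) = g i₀ (f.ring r))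
    (hu : ∀ i p, u i (f.mon p) = 1) (hα : ∀ i m, g i (Y.α m) = g i₀ (Y.α m) * u i m)

@[simp]
theorem lift_ι (i : Fin n) (a : Y.Ring) : lift i₀ g u hg hu hα (ι f n i a) = g i a := by
  simp [lift, ι]

@[simp]
theorem lift_ratio (i j : Fin n) (m : Y.Mon) :
    lift i₀ g u hg hu hα (ratio f n i j m) = ((u j m / u i m : Tˣ) : T) := by
  rw [coe_ratio, lift, RingPushout.lift_inr, monoidRingLift_of, RepAmalg.lift_ratio]

end lift

end PreLogHom.Bar

end LogHH

/-! ### Pushout squares of rings and flatness -/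

/-- Replaces a computation of tensor products by a check of the universal property, through pushouts
in the category of commutative rings. -/
theorem Algebra.isPushout_of_universal {R R' S S' : Type u} [CommRing R] [CommRing R']
    [CommRing S] [CommRing S'] [Algebra R R'] [Algebra R S] [Algebra R S'] [Algebra R' S']
    [Algebra S S'] [IsScalarTower R R' S'] [IsScalarTower R S S']
    (hex : ∀ (T : Type u) [CommRing T] (p : R' →+* T) (q : S →+* T),
      p.comp (algebraMap R R') = q.comp (algebraMap R S) →
        ∃ d : S' →+* T, d.comp (algebraMap R' S') = p ∧ d.comp (algebraMap S S') = q)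
    (hext : ∀ (T : Type u) [CommRing T] (d d' : S' →+* T),
      d.comp (algebraMap R' S') = d'.comp (algebraMap R' S') →
      d.comp (algebraMap S S') = d'.comp (algebraMap S S') → d = d') :
    Algebra.IsPushout R R' S S' := by
  rw [← CommRingCat.isPushout_iff_isPushout]
  have w : CommRingCat.ofHom (algebraMap R R') ≫ CommRingCat.ofHom (algebraMap R' S') =
      CommRingCat.ofHom (algebraMap R S) ≫ CommRingCat.ofHom (algebraMap S S') := by
    ext x
    exact (IsScalarTower.algebraMap_apply R R' S' x).symm.trans
      (IsScalarTower.algebraMap_apply R S S' x)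
  have hex' (s : Limits.PushoutCocone (CommRingCat.ofHom (algebraMap R R'))
      (CommRingCat.ofHom (algebraMap R S))) :=
    hex s.pt s.inl.hom s.inr.hom (congrArg CommRingCat.Hom.hom s.condition)
  choose d hd using hex'
  exact ⟨⟨w⟩, ⟨Limits.PushoutCocone.IsColimit.mk w (fun s => CommRingCat.ofHom (d s))
    (fun s => CommRingCat.hom_ext (hd s).1) (fun s => CommRingCat.hom_ext (hd s).2)
    (fun s m h1 h2 => CommRingCat.hom_ext (hext _ _ _
      ((congrArg CommRingCat.Hom.hom h1).trans (hd s).1.symm)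
      ((congrArg CommRingCat.Hom.hom h2).trans (hd s).2.symm)))⟩⟩

theorem RingHom.Flat.of_universal {A B C D : Type u} [CommRing A] [CommRing B] [CommRing C]
    [CommRing D] (f : A →+* B) (g : A →+* C) (i : B →+* D) (j : C →+* D)
    (comm : i.comp f = j.comp g)
    (hex : ∀ (T : Type u) [CommRing T] (p : B →+* T) (q : C →+* T),
      p.comp f = q.comp g → ∃ d : D →+* T, d.comp i = p ∧ d.comp j = q)
    (hext : ∀ (T : Type u) [CommRing T] (d d' : D →+* T),
      d.comp i = d'.comp i → d.comp j = d'.comp j → d = d')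
    (hg : g.Flat) : i.Flat := by
  algebraize [f, g, i, j, i.comp f]
  have : IsScalarTower A C D := .of_algebraMap_eq fun x => RingHom.congr_fun comm x
  have : Algebra.IsPushout A C B D := (Algebra.isPushout_of_universal hex hext).symm
  exact RingHom.Flat.isStableUnderBaseChange A C B D hg

/-! ### Adding positions one at a time, and gluing the end points -/

namespace LogHH.PreLogHom

variable {X Y : PreLogRing.{u}} (f : PreLogHom X Y)

namespace Bar

/-- The universal property of `B_{k+1}` is applied with base position `j.succAbove i₀`: `p` supplies
the data at all positions other than `j`, and `q` supplies the data at `j`. The hypothesis `hp` says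
that they agree on the factor `A` at the base position. -/
theorem exists_lift_succAbove {k : ℕ} (i₀ : Fin k) (j : Fin (k + 1)) {T : Type u} [CommRing T]
    (p : f.Bar k →+* T) (q : f.Bar 2 →+* T) (hp : ∀ a, p (ι f k i₀ a) = q (ι f 2 0 a)) :
    ∃ d : f.Bar (k + 1) →+* T, d.comp (map f j.succAbove) = p ∧
      d.comp (map f ![j.succAbove i₀, j]) = q := by
  let g : Fin (k + 1) → Y.Ring →+* T := Fin.insertNth (α := fun _ => Y.Ring →+* T) j
    (q.comp (ι f 2 1)) fun i => p.comp (ι f k i)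
  -- All ratios are taken relative to the base position, so the character there is trivial (`us0`).
  let u : Fin (k + 1) → Y.Mon →* Tˣ := Fin.insertNth (α := fun _ => Y.Mon →* Tˣ) j
    ((Units.map (q : _ →* T)).comp (ratio f 2 0 1))
    fun i => (Units.map (p : _ →* T)).comp (ratio f k i₀ i)
  have gj (a : Y.Ring) : g j a = q (ι f 2 1 a) :=
    RingHom.congr_fun (Fin.insertNth_apply_same (α := fun _ => Y.Ring →+* T) ..) a
  have gs (i : Fin k) (a : Y.Ring) : g (j.succAbove i) a = p (ι f k i a) :=
    RingHom.congr_fun (Fin.insertNth_apply_succAbove (α := fun _ => Y.Ring →+* T) ..) a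
  have uj (m : Y.Mon) : u j m = Units.map (q : _ →* T) (ratio f 2 0 1 m) :=
    DFunLike.congr_fun (Fin.insertNth_apply_same (α := fun _ => Y.Mon →* Tˣ) ..) m
  have us (i : Fin k) (m : Y.Mon) :
      u (j.succAbove i) m = Units.map (p : _ →* T) (ratio f k i₀ i m) :=
    DFunLike.congr_fun (Fin.insertNth_apply_succAbove (α := fun _ => Y.Mon →* Tˣ) ..) m
  have us0 (m : Y.Mon) : u (j.succAbove i₀) m = 1 := by
    rw [us, ratio_self, map_one]
  clear_value g u
  have h1 : ∀ i r, g i (f.ring r) = g (j.succAbove i₀) (f.ring r) := by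
    refine (Fin.forall_iff_succAbove j).mpr ⟨fun r => ?_, fun i r => ?_⟩
    · rw [gj, gs, hp, ι_ring f 1 0]
    · rw [gs, gs, ι_ring f i i₀]
  have h2 : ∀ i r, u i (f.mon r) = 1 := by
    refine (Fin.forall_iff_succAbove j).mpr ⟨fun r => ?_, fun i r => ?_⟩
    · rw [uj, ratio_mon, map_one]
    · rw [us, ratio_mon, map_one]
  have h3 : ∀ i m, g i (Y.α m) = g (j.succAbove i₀) (Y.α m) * u i m := by
    refine (Fin.forall_iff_succAbove j).mpr ⟨fun m => ?_, fun i m => ?_⟩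
    · rw [gj, gs, uj, hp, ι_α f 0 1, map_mul]
      rfl
    · rw [gs, gs, us, ι_α f i₀ i, map_mul]
      rfl
  have hdι := lift_ι (j.succAbove i₀) g u h1 h2 h3
  have hdr := lift_ratio (j.succAbove i₀) g u h1 h2 h3 (j.succAbove i₀)
  generalize lift (j.succAbove i₀) g u h1 h2 h3 = d at hdι hdr
  refine ⟨d, hom_ext i₀ (fun i a => ?_) (fun i m => ?_),
    hom_ext 0 (Fin.forall_fin_two.mpr ⟨fun a => ?_, fun a => ?_⟩)
      (Fin.forall_fin_two.mpr ⟨fun m => ?_, fun m => ?_⟩)⟩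
  · rw [RingHom.comp_apply, map_ι, hdι, gs]
  · rw [RingHom.comp_apply, map_ratio, hdr, us0, us, div_one]
    rfl
  · rw [RingHom.comp_apply, map_ι, hdι, Matrix.cons_val_zero, gs, hp]
  · rw [RingHom.comp_apply, map_ι, hdι, Matrix.cons_val_one, Matrix.cons_val_fin_one, gj]
  · rw [ratio_self, Units.val_one, map_one, map_one]
  · rw [RingHom.comp_apply, map_ratio, Matrix.cons_val_zero, Matrix.cons_val_one,
      Matrix.cons_val_fin_one, hdr, us0, uj, div_one]
    rfl

/-- `B_{k+1}` is the pushout of `B_k` and `B_2` over `A`. -/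
theorem flat_map_succAbove {k : ℕ} (i₀ : Fin k) (j : Fin (k + 1)) (h : (ι f 2 0).Flat) :
    (map f j.succAbove).Flat := by
  refine RingHom.Flat.of_universal (ι f k i₀) (ι f 2 0) (map f j.succAbove)
    (map f ![j.succAbove i₀, j]) ?_
    (fun T _ p q hpq => exists_lift_succAbove f i₀ j p q (RingHom.congr_fun hpq))
    (fun T _ d d' h1 h2 => ?_) h
  · ext a
    rw [RingHom.comp_apply, RingHom.comp_apply, map_ι, map_ι, Matrix.cons_val_zero]
  · refine hom_ext (j.succAbove i₀) ((Fin.forall_iff_succAbove j).mpr ⟨fun a => ?_, fun i a => ?_⟩)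
      ((Fin.forall_iff_succAbove j).mpr ⟨fun m => ?_, fun i m => ?_⟩)
    · have := RingHom.congr_fun h2 (ι f 2 1 a)
      rwa [RingHom.comp_apply, RingHom.comp_apply, map_ι] at this
    · have := RingHom.congr_fun h1 (ι f k i a)
      rwa [RingHom.comp_apply, RingHom.comp_apply, map_ι] at this
    · have := RingHom.congr_fun h2 (ratio f 2 0 1 m)
      rwa [RingHom.comp_apply, RingHom.comp_apply, map_ratio] at this
    · have := RingHom.congr_fun h1 (ratio f k i₀ i m)
      rwa [RingHom.comp_apply, RingHom.comp_apply, map_ratio] at this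

/-- The inclusion of the two end points. -/
abbrev ends (n : ℕ) : Fin 2 → Fin (n + 2) := ![0, Fin.last (n + 1)]

/-- Interior positions are inserted one at a time: the ends of the longer interval are those of the
shorter one, followed by the map that skips position `1`. -/
theorem flat_map_ends (h : (ι f 2 0).Flat) : ∀ n : ℕ, (map f (ends n)).Flat
  | 0 => by
    have : ends 0 = id := by decide
    rw [this, map_id]
    exact RingHom.Flat.id _
  | n + 1 => by
    have : ends (n + 1) = (1 : Fin (n + 3)).succAbove ∘ ends n := by
      refine funext (Fin.forall_fin_two.mpr ⟨?_, ?_⟩)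
      · exact (Fin.succAbove_ne_zero_zero (by simp)).symm
      · change Fin.last (n + 2) = (1 : Fin (n + 3)).succAbove (Fin.last (n + 1))
        exact (Fin.succAbove_ne_last_last (by simp [Fin.ext_iff])).symm
    rw [this, ← map_comp]
    exact (flat_map_ends h n).comp (flat_map_succAbove f 0 1 h)

/-- The identification of the end points of the interval. -/
def glue (n : ℕ) : Fin (n + 2) → Fin (n + 1) := Fin.lastCases 0 id

@[simp]
theorem glue_last (n : ℕ) : glue n (Fin.last (n + 1)) = 0 := Fin.lastCases_last

@[simp]
theorem glue_castSucc (n : ℕ) (i : Fin (n + 1)) : glue n i.castSucc = i :=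
  Fin.lastCases_castSucc ..

@[simp]
theorem glue_zero (n : ℕ) : glue n 0 = 0 := glue_castSucc n 0

/-- Once the ends coincide, both end factors become the factor `0` and their ratio becomes `1`,
exactly as under the augmentation. -/
theorem map_glue_comp_map_ends (n : ℕ) :
    (map f (glue n)).comp (map f (ends n)) = (ι f (n + 1) 0).comp (fold f 2) := by
  refine hom_ext 0 ?_ ?_
  · refine Fin.forall_fin_two.mpr ⟨fun a => ?_, fun a => ?_⟩ <;>
    simp [map_ι, fold_ι]
  · refine Fin.forall_fin_two.mpr ⟨fun a => ?_, fun a => ?_⟩ <;>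
    simp [fold_ratio, ratio_self]

/-- The hypothesis forces `q` to agree on the two end factors and to send their ratio to `1`, so `q`
loses nothing when the last position is dropped. -/
theorem exists_lift_glue (n : ℕ) (T : Type u) [CommRing T] (p : Y.Ring →+* T)
    (q : f.Bar (n + 2) →+* T) (h : p.comp (fold f 2) = q.comp (map f (ends n))) :
    ∃ d : f.Bar (n + 1) →+* T, d.comp (ι f (n + 1) 0) = p ∧ d.comp (map f (glue n)) = q := by
  have h0 (a : Y.Ring) : q (ι f (n + 2) 0 a) = p a := by
    simpa [map_ι, fold_ι] using (RingHom.congr_fun h (ι f 2 0 a)).symm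
  have h1 (a : Y.Ring) : q (ι f (n + 2) (Fin.last (n + 1)) a) = p a := by
    simpa [map_ι, fold_ι] using (RingHom.congr_fun h (ι f 2 1 a)).symm
  have h2 (m : Y.Mon) : q (ratio f (n + 2) 0 (Fin.last (n + 1)) m) = 1 := by
    simpa [fold_ratio] using (RingHom.congr_fun h (ratio f 2 0 1 m)).symm
  -- `Fin.castSucc` is a section of `glue n`; the same section gives uniqueness in `hom_ext_glue`.
  refine ⟨q.comp (map f Fin.castSucc), RingHom.ext fun a => ?_, hom_ext 0 ?_ ?_⟩
  · simpa [map_ι] using h0 a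
  · refine Fin.lastCases (fun a => ?_) fun i a => ?_
    · simp [map_ι, h0, h1]
    · simp [map_ι]
  · refine Fin.lastCases (fun m => ?_) fun i m => ?_
    · simp [h2, ratio_self]
    · simp

theorem hom_ext_glue (n : ℕ) (T : Type u) [CommRing T] (d d' : f.Bar (n + 1) →+* T)
    (h : d.comp (map f (glue n)) = d'.comp (map f (glue n))) : d = d' := by
  have h1 : (map f (glue n)).comp (map f Fin.castSucc) = RingHom.id _ := by
    rw [map_comp, ← map_id]
    exact congrArg (map f) (funext (glue_castSucc n))
  simpa [RingHom.comp_assoc, h1] using congrArg (RingHom.comp · (map f Fin.castSucc)) h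

end Bar

end LogHH.PreLogHom

/-! ### Flatness of `A → B_2` in the presence of a chart -/

namespace LogHH.PreLogHom

variable {X Y : PreLogRing.{u}} (f : PreLogHom X Y)

section chart

variable {P₁ P₂ M₁ M₂ : Type u} [CommMonoid P₁] [CommGroup P₂] [CommMonoid M₁] [CommGroup M₂]
  (eP : P₁ × P₂ ≃* X.Mon) (eM : M₁ × M₂ ≃* Y.Mon) (φ₁ : P₁ →* M₁) (φ₂ : P₂ →* M₂)
  (hφ : ∀ p : P₁ × P₂, f.mon (eP p) = eM (φ₁ p.1, φ₂ p.2))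

/-- The cokernel of `P₁^gp → M₁^gp`. -/
abbrev GpCoker : Type u := Algebra.GrothendieckGroup M₁ ⧸ (gpMap φ₁).range

/-- The canonical map from `M₁` to the cokernel of `P₁^gp → M₁^gp`. -/
def toGpCoker : M₁ →* GpCoker φ₁ :=
  (QuotientGroup.mk' (gpMap φ₁).range).comp Algebra.GrothendieckGroup.of

theorem toGpCoker_map (p : P₁) : toGpCoker φ₁ (φ₁ p) = 1 :=
  (QuotientGroup.eq_one_iff _).mpr ⟨Algebra.GrothendieckGroup.of p, gpMap_of _ _⟩

/-- The homomorphism out of the cokernel given by a homomorphism on `M₁`. -/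
def gpCokerLift {G : Type*} [CommGroup G] (a : M₁ →* G) (h : ∀ p, a (φ₁ p) = 1) :
    GpCoker φ₁ →* G :=
  QuotientGroup.lift _ (Algebra.GrothendieckGroup.lift a) (by
    rintro _ ⟨x, rfl⟩
    have : (Algebra.GrothendieckGroup.lift a).comp (gpMap φ₁) = 1 :=
      gp_hom_ext (MonoidHom.ext fun p => by
        rw [MonoidHom.comp_apply, MonoidHom.comp_apply, gpMap_of, RepAmalg.lift_gp_of, h]
        rfl)
    exact DFunLike.congr_fun this x)

theorem gpCokerLift_toGpCoker {G : Type*} [CommGroup G] (a : M₁ →* G) (h : ∀ p, a (φ₁ p) = 1)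
    (m : M₁) : gpCokerLift φ₁ a h (toGpCoker φ₁ m) = a m :=
  RepAmalg.lift_gp_of a m

theorem gpCoker_hom_ext {T : Type*} [CommMonoid T] {a b : GpCoker φ₁ →* T}
    (h : ∀ m, a (toGpCoker φ₁ m) = b (toGpCoker φ₁ m)) : a = b := by
  have : a.toHomUnits = b.toHomUnits := QuotientGroup.monoidHom_ext _
    (gp_hom_ext (MonoidHom.ext fun m => Units.ext (h m)))
  exact MonoidHom.ext fun x => congrArg Units.val (DFunLike.congr_fun this x)

theorem mon_inl (p : P₁) (h : ∀ p : P₁ × P₂, f.mon (eP p) = eM (φ₁ p.1, φ₂ p.2)) :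
    f.mon (eP (p, 1)) = eM (φ₁ p, 1) := by
  simpa using h (p, 1)

/-- The map `R ⊗_{ℤ[P₁]} ℤ[M₁] → A[M₁^gp / P₁^gp]`, `m ↦ α m * [m]`. -/
def chartToGroupRing :
    RingPushout (monoidRingLift (X.α.comp (eP.toMonoidHom.comp (MonoidHom.inl P₁ P₂))))
      (monoidRingMap φ₁) →+* MonoidAlgebra Y.Ring (GpCoker φ₁) :=
  RingPushout.lift (MonoidAlgebra.singleOneRingHom.comp f.ring)
    (monoidRingLift (((MonoidAlgebra.singleOneRingHom :
        Y.Ring →+* MonoidAlgebra Y.Ring (GpCoker φ₁)) : Y.Ring →* _).comp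
          (Y.α.comp (eM.toMonoidHom.comp (MonoidHom.inl M₁ M₂))) *
      (MonoidAlgebra.of Y.Ring (GpCoker φ₁)).comp (toGpCoker φ₁)))
    (monoidRing_hom_ext fun p => by
      have h := mon_inl f eP eM φ₁ φ₂ p hφ
      simp [monoidRingLift, ← f.comm, h, toGpCoker_map])

theorem chartToGroupRing_inl (r : X.Ring) :
    chartToGroupRing f eP eM φ₁ φ₂ hφ (RingPushout.inl _ _ r) =
      MonoidAlgebra.singleOneRingHom (f.ring r) :=
  RingPushout.lift_inl ..

theorem chartToGroupRing_inr (m : M₁) :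
    chartToGroupRing f eP eM φ₁ φ₂ hφ (RingPushout.inr _ _ (MonoidAlgebra.of ℤ M₁ m)) =
      MonoidAlgebra.singleOneRingHom (Y.α (eM (m, 1))) *
        MonoidAlgebra.of Y.Ring (GpCoker φ₁) (toGpCoker φ₁ m) :=
  (RingPushout.lift_inr ..).trans (monoidRingLift_of ..)

theorem chartMap_inl (r : X.Ring) :
    f.chartMap eP eM φ₁ φ₂ hφ (RingPushout.inl _ _ r) = f.ring r :=
  RingPushout.lift_inl ..

theorem chartMap_inr (m : M₁) :
    f.chartMap eP eM φ₁ φ₂ hφ (RingPushout.inr _ _ (MonoidAlgebra.of ℤ M₁ m)) =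
      Y.α (eM (m, 1)) :=
  (RingPushout.lift_inr ..).trans (monoidRingLift_of ..)

/-- The map `A[M₁^gp / P₁^gp] → B_2`, `m ↦ (1, ι_1 m / ι_0 m)`. -/
def groupRingToBar : MonoidAlgebra Y.Ring (GpCoker φ₁) →+* f.Bar 2 :=
  MonoidAlgebra.liftNCRingHom (Bar.ι f 2 0)
    ((Units.coeHom _).comp (gpCokerLift φ₁
      ((Bar.ratio f 2 0 1).comp (eM.toMonoidHom.comp (MonoidHom.inl M₁ M₂)))
      (fun p => by
        have h := mon_inl f eP eM φ₁ φ₂ p hφ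
        change Bar.ratio f 2 0 1 (eM (φ₁ p, 1)) = 1
        rw [← h, Bar.ratio_mon])))
    (fun _ _ => Commute.all _ _)

theorem groupRingToBar_single (a : Y.Ring) :
    groupRingToBar f eP eM φ₁ φ₂ hφ (MonoidAlgebra.singleOneRingHom a) = Bar.ι f 2 0 a := by
  simp [groupRingToBar]

theorem groupRingToBar_of (m : M₁) :
    groupRingToBar f eP eM φ₁ φ₂ hφ (MonoidAlgebra.of Y.Ring _ (toGpCoker φ₁ m)) =
      Bar.ratio f 2 0 1 (eM (m, 1)) := by
  simp [groupRingToBar, gpCokerLift_toGpCoker]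

/-- Commutativity of the square that exhibits `B_2` as a pushout; on `M₁` it is the relation
`Bar.ι_α`. -/
theorem groupRingToBar_comp_chartToGroupRing :
    (groupRingToBar f eP eM φ₁ φ₂ hφ).comp (chartToGroupRing f eP eM φ₁ φ₂ hφ) =
      (Bar.ι f 2 1).comp (f.chartMap eP eM φ₁ φ₂ hφ) := by
  refine RingPushout.hom_ext (RingHom.ext fun r => ?_) (monoidRing_hom_ext fun m => ?_)
  · rw [RingHom.comp_apply, RingHom.comp_apply, chartToGroupRing_inl, groupRingToBar_single,
      RingHom.comp_apply, RingHom.comp_apply, chartMap_inl, Bar.ι_ring f 0 1]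
  · rw [RingHom.comp_apply, RingHom.comp_apply, chartToGroupRing_inr, map_mul,
      groupRingToBar_single, groupRingToBar_of, RingHom.comp_apply, RingHom.comp_apply,
      chartMap_inr, Bar.ι_α f 0 1]

/-- A map out of `B_2` requires ring maps `s` and `q` at the two positions and a character `v` of
`M`. On `M₁` the character is read off from the group elements of `A[M₁^gp / P₁^gp]`; on `M₂` it has
to be the quotient of `q ∘ α` by `s ∘ α`. -/
theorem exists_lift_chart {T : Type u} [CommRing T]
    (p : MonoidAlgebra Y.Ring (GpCoker φ₁) →+* T) (q : Y.Ring →+* T)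
    (hpq : p.comp (chartToGroupRing f eP eM φ₁ φ₂ hφ) =
      q.comp (f.chartMap eP eM φ₁ φ₂ hφ)) :
    ∃ d : f.Bar 2 →+* T, d.comp (groupRingToBar f eP eM φ₁ φ₂ hφ) = p ∧
      d.comp (Bar.ι f 2 1) = q := by
  let s : Y.Ring →+* T := p.comp MonoidAlgebra.singleOneRingHom
  have hring (r : X.Ring) : q (f.ring r) = s (f.ring r) := by
    have := RingHom.congr_fun hpq (RingPushout.inl _ _ r)
    rw [RingHom.comp_apply, RingHom.comp_apply, chartToGroupRing_inl, chartMap_inl] at this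
    exact this.symm
  let a : M₁ →* Tˣ :=
    ((p : _ →* T).comp (MonoidAlgebra.of Y.Ring _)).toHomUnits.comp (toGpCoker φ₁)
  have ha (m : M₁) : q (Y.α (eM (m, 1))) = s (Y.α (eM (m, 1))) * a m := by
    have := RingHom.congr_fun hpq (RingPushout.inr _ _ (MonoidAlgebra.of ℤ M₁ m))
    rw [RingHom.comp_apply, RingHom.comp_apply, chartToGroupRing_inr, chartMap_inr, map_mul] at this
    exact this.symm
  have ha' (p : P₁) : a (φ₁ p) = 1 := by
    change MonoidHom.toHomUnits _ (toGpCoker φ₁ (φ₁ p)) = 1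
    rw [toGpCoker_map, map_one]
  let e₂ : M₂ →* Y.Ring := Y.α.comp (eM.toMonoidHom.comp (MonoidHom.inr M₁ M₂))
  -- The quotient makes sense because the elements of the group `M₂` go to units of `T`.
  let b : M₂ →* Tˣ := ((q : _ →* T).comp e₂).toHomUnits / ((s : _ →* T).comp e₂).toHomUnits
  have hb (m : M₂) : q (Y.α (eM (1, m))) = s (Y.α (eM (1, m))) * b m := by
    change (((q : _ →* T).comp e₂).toHomUnits m : T) = (((s : _ →* T).comp e₂).toHomUnits m : T) *
      ((((q : _ →* T).comp e₂).toHomUnits m / ((s : _ →* T).comp e₂).toHomUnits m : Tˣ) : T)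
    rw [← Units.val_mul, mul_div_cancel]
  have hb' (p : P₂) : b (φ₂ p) = 1 := by
    have h : f.mon (eP (1, p)) = eM (1, φ₂ p) := by simpa using hφ (1, p)
    refine div_eq_one.mpr (Units.ext ?_)
    change q (Y.α (eM (1, φ₂ p))) = s (Y.α (eM (1, φ₂ p)))
    rw [← h, f.comm, hring]
  let v : Y.Mon →* Tˣ := (a.coprod b).comp eM.symm.toMonoidHom
  have hv (m₁ : M₁) (m₂ : M₂) : v (eM (m₁, m₂)) = a m₁ * b m₂ := by
    change a.coprod b (eM.symm (eM (m₁, m₂))) = _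
    rw [eM.symm_apply_apply]
    rfl
  have hv' (x : X.Mon) : v (f.mon x) = 1 := by
    obtain ⟨⟨p₁, p₂⟩, rfl⟩ := eP.surjective x
    rw [hφ, hv, ha', hb', one_mul]
  have hα (m : Y.Mon) : q (Y.α m) = s (Y.α m) * v m := by
    obtain ⟨⟨m₁, m₂⟩, rfl⟩ := eM.surjective m
    have : eM (m₁, m₂) = eM (m₁, 1) * eM (1, m₂) := by rw [← map_mul]; simp
    rw [hv, this, map_mul, map_mul, map_mul, ha, hb, Units.val_mul]
    ring
  clear_value v
  have h1 : ∀ i r, (![s, q] : Fin 2 → Y.Ring →+* T) i (f.ring r) =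
      (![s, q] : Fin 2 → Y.Ring →+* T) 0 (f.ring r) :=
    Fin.forall_fin_two.mpr ⟨fun r => rfl, hring⟩
  have h2 : ∀ i x, (![1, v] : Fin 2 → Y.Mon →* Tˣ) i (f.mon x) = 1 :=
    Fin.forall_fin_two.mpr ⟨fun r => rfl, hv'⟩
  have h3 : ∀ i m, (![s, q] : Fin 2 → Y.Ring →+* T) i (Y.α m) =
      (![s, q] : Fin 2 → Y.Ring →+* T) 0 (Y.α m) * (![1, v] : Fin 2 → Y.Mon →* Tˣ) i m :=
    Fin.forall_fin_two.mpr ⟨fun m => (mul_one _).symm, hα⟩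
  have hd0 (x : Y.Ring) := Bar.lift_ι (f := f) 0 ![s, q] ![1, v] h1 h2 h3 0 x
  have hd1 (x : Y.Ring) := Bar.lift_ι (f := f) 0 ![s, q] ![1, v] h1 h2 h3 1 x
  have hdr (x : Y.Mon) := Bar.lift_ratio (f := f) 0 ![s, q] ![1, v] h1 h2 h3 0 1 x
  generalize Bar.lift (f := f) 0 ![s, q] ![1, v] h1 h2 h3 = d at hd0 hd1 hdr
  refine ⟨d, MonoidAlgebra.ringHom_ext (fun x => ?_) ?_, RingHom.ext hd1⟩
  · exact (congrArg d (groupRingToBar_single ..)).trans (hd0 x)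
  · refine DFunLike.congr_fun (gpCoker_hom_ext φ₁
      (a := (((d.comp (groupRingToBar f eP eM φ₁ φ₂ hφ)) : _ →* T)).comp (MonoidAlgebra.of Y.Ring _))
      (b := ((p : _ →* T)).comp (MonoidAlgebra.of Y.Ring _)) fun m => ?_)
    refine (congrArg d (groupRingToBar_of ..)).trans ((hdr _).trans ?_)
    have : v (eM (m, 1)) = a m := by rw [hv, map_one, mul_one]
    change ((v (eM (m, 1)) / 1 : Tˣ) : T) = _
    rw [div_one, this]
    rfl

theorem hom_ext_chart {T : Type u} [CommRing T] {d d' : f.Bar 2 →+* T}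
    (hi : d.comp (groupRingToBar f eP eM φ₁ φ₂ hφ) = d'.comp (groupRingToBar f eP eM φ₁ φ₂ hφ))
    (hj : d.comp (Bar.ι f 2 1) = d'.comp (Bar.ι f 2 1)) : d = d' := by
  have h0 (a : Y.Ring) : d (Bar.ι f 2 0 a) = d' (Bar.ι f 2 0 a) := by
    rw [← groupRingToBar_single f eP eM φ₁ φ₂ hφ]
    exact RingHom.congr_fun hi _
  have hm₁ (m : M₁) :
      d (Bar.ratio f 2 0 1 (eM (m, 1))) = d' (Bar.ratio f 2 0 1 (eM (m, 1))) := by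
    rw [← groupRingToBar_of f eP eM φ₁ φ₂ hφ]
    exact RingHom.congr_fun hi _
  have hm₂ (m : M₂) :
      d (Bar.ratio f 2 0 1 (eM (1, m))) = d' (Bar.ratio f 2 0 1 (eM (1, m))) := by
    -- The ratio of an element of `M₂` is determined by the two maps from `A`, by cancelling this
    -- unit in `Bar.ι_α`.
    have hu : IsUnit (d (Bar.ι f 2 0 (Y.α (eM (1, m))))) :=
      ((Group.isUnit m).map (Y.α.comp (eM.toMonoidHom.comp (MonoidHom.inr M₁ M₂)))).map
        (d.comp (Bar.ι f 2 0))
    refine hu.mul_left_cancel ?_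
    rw [← map_mul, ← Bar.ι_α, h0, ← map_mul, ← Bar.ι_α]
    exact RingHom.congr_fun hj _
  refine Bar.hom_ext 0 (Fin.forall_fin_two.mpr ⟨h0, RingHom.congr_fun hj⟩)
    (Fin.forall_fin_two.mpr ⟨fun m => ?_, fun m => ?_⟩)
  · rw [Bar.ratio_self, Units.val_one, map_one, map_one]
  · obtain ⟨⟨m₁, m₂⟩, rfl⟩ := eM.surjective m
    have : eM (m₁, m₂) = eM (m₁, 1) * eM (1, m₂) := by rw [← map_mul]; simp
    rw [this, map_mul, Units.val_mul, map_mul, map_mul, hm₁, hm₂]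

/-- The map factors as `A → A[M₁^gp / P₁^gp] → B_2`: a free extension, then a base change of the
chart map. -/
theorem flat_ι_zero (hflat : (f.chartMap eP eM φ₁ φ₂ hφ).Flat) : (Bar.ι f 2 0).Flat := by
  have h1 : (groupRingToBar f eP eM φ₁ φ₂ hφ).Flat :=
    RingHom.Flat.of_universal (chartToGroupRing f eP eM φ₁ φ₂ hφ) (f.chartMap eP eM φ₁ φ₂ hφ)
      (groupRingToBar f eP eM φ₁ φ₂ hφ) (Bar.ι f 2 1)
      (groupRingToBar_comp_chartToGroupRing f eP eM φ₁ φ₂ hφ)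
      (fun T _ p q h => exists_lift_chart f eP eM φ₁ φ₂ hφ p q h)
      (fun T _ d d' h h' => hom_ext_chart f eP eM φ₁ φ₂ hφ h h') hflat
  have h2 : (MonoidAlgebra.singleOneRingHom :
      Y.Ring →+* MonoidAlgebra Y.Ring (GpCoker φ₁)).Flat :=
    RingHom.flat_algebraMap_iff.mpr (inferInstance :
      Module.Flat Y.Ring (MonoidAlgebra Y.Ring (GpCoker φ₁)))
  have h3 : Bar.ι f 2 0 = (groupRingToBar f eP eM φ₁ φ₂ hφ).comp MonoidAlgebra.singleOneRingHom :=
    RingHom.ext fun a => (groupRingToBar_single f eP eM φ₁ φ₂ hφ a).symm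
  rw [h3]
  exact h2.comp h1

end chart

end LogHH.PreLogHom

/-! ### The simplicial interval -/

namespace LogHH

/-- The action of a monotone map `θ : [m] → [n]` on the simplicial interval, whose set of
`n`-simplices is `{0, …, n + 1}`: the simplex `k` stands for the map `[n] → [1]` with `i ↦ 0` iff
`i < k`, and `θ` acts by precomposition. -/
def interval {m n : SimplexCategory} (θ : m ⟶ n) (k : Fin (n.len + 2)) : Fin (m.len + 2) :=
  ⟨Finset.card {i : Fin (m.len + 1) | (θ.toOrderHom i).castSucc < k}, by
    have := Finset.card_le_univ
      ({i : Fin (m.len + 1) | (θ.toOrderHom i).castSucc < k} : Finset _)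
    rw [Fintype.card_fin] at this
    omega⟩

/-- By monotonicity the set counted in `interval` is an initial segment, so its cardinality is the
position of the cut. Since a cut determines the simplex, functoriality reduces to precomposition. -/
theorem castSucc_lt_interval {m n : SimplexCategory} (θ : m ⟶ n) (k : Fin (n.len + 2))
    (j : Fin (m.len + 1)) : j.castSucc < interval θ k ↔ (θ.toOrderHom j).castSucc < k := by
  change (j : ℕ) < Finset.card {i : Fin (m.len + 1) | (θ.toOrderHom i).castSucc < k} ↔ _
  constructor
  · intro hj
    by_contra hk
    have : ({i : Fin (m.len + 1) | (θ.toOrderHom i).castSucc < k} : Finset _) ⊆ Finset.Iio j :=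
      fun i hi => by
        rw [Finset.mem_Iio]
        by_contra h
        exact hk (lt_of_le_of_lt (Fin.castSucc_le_castSucc_iff.mpr
          (θ.toOrderHom.monotone (not_lt.mp h))) (Finset.mem_filter.mp hi).2)
    have := Finset.card_le_card this
    rw [Fin.card_Iio] at this
    omega
  · intro hj
    have : Finset.Iic j ⊆ ({i : Fin (m.len + 1) | (θ.toOrderHom i).castSucc < k} : Finset _) :=
      fun i hi => Finset.mem_filter.mpr ⟨Finset.mem_univ _, lt_of_le_of_lt
        (Fin.castSucc_le_castSucc_iff.mpr (θ.toOrderHom.monotone (Finset.mem_Iic.mp hi))) hj⟩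
    have := Finset.card_le_card this
    rw [Fin.card_Iic] at this
    omega

theorem fin_eq_of_castSucc_lt_iff {m : ℕ} {a b : Fin (m + 1)}
    (h : ∀ j : Fin m, j.castSucc < a ↔ j.castSucc < b) : a = b := by
  by_contra hab
  wlog hlt : a < b generalizing a b
  · exact this (fun j => (h j).symm) (Ne.symm hab) (lt_of_le_of_ne (not_lt.mp hlt) (Ne.symm hab))
  have := (h ⟨a, by omega⟩).mpr hlt
  exact lt_irrefl _ this

theorem interval_eq_iff {m n : SimplexCategory} (θ : m ⟶ n) (k : Fin (n.len + 2))
    (a : Fin (m.len + 2)) :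
    interval θ k = a ↔ ∀ j, (θ.toOrderHom j).castSucc < k ↔ j.castSucc < a :=
  ⟨fun h j => by rw [← h, castSucc_lt_interval],
    fun h => fin_eq_of_castSucc_lt_iff fun j => (castSucc_lt_interval θ k j).trans (h j)⟩

theorem interval_id (n : SimplexCategory) : interval (𝟙 n) = id :=
  funext fun _ => (interval_eq_iff _ _ _).mpr fun _ => Iff.rfl

theorem interval_comp {l m n : SimplexCategory} (ψ : l ⟶ m) (θ : m ⟶ n) :
    interval (ψ ≫ θ) = interval ψ ∘ interval θ :=
  funext fun k => (interval_eq_iff _ _ _).mpr fun j =>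
    ((castSucc_lt_interval ψ _ j).trans (castSucc_lt_interval θ k _)).symm

theorem interval_zero {m n : SimplexCategory} (θ : m ⟶ n) : interval θ 0 = 0 :=
  (interval_eq_iff _ _ _).mpr fun _ => by simp

theorem interval_last {m n : SimplexCategory} (θ : m ⟶ n) :
    interval θ (Fin.last _) = Fin.last _ :=
  (interval_eq_iff _ _ _).mpr fun _ => by simp [Fin.castSucc_lt_last]

theorem interval_comp_ends {m n : SimplexCategory} (θ : m ⟶ n) :
    interval θ ∘ PreLogHom.Bar.ends n.len = PreLogHom.Bar.ends m.len :=
  funext (Fin.forall_fin_two.mpr ⟨interval_zero θ, interval_last θ⟩)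

theorem interval_δ {n : ℕ} (i : Fin (n + 2)) :
    interval (SimplexCategory.δ i) = (i.predAbove : Fin (n + 3) → Fin (n + 2)) :=
  funext fun k => (interval_eq_iff _ _ _).mpr fun j => by
    change (i.succAbove j).castSucc < k ↔ j.castSucc < i.predAbove k
    rcases lt_or_ge i.castSucc k with hk | hk <;> rcases lt_or_ge j.castSucc i with hj | hj
    · rw [Fin.predAbove_of_castSucc_lt _ _ hk, Fin.succAbove_of_castSucc_lt _ _ hj]
      have hk' : (i : ℕ) < k := hk
      have hj' : (j : ℕ) < i := hj
      change (j : ℕ) < k ↔ (j : ℕ) < k - 1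
      omega
    · rw [Fin.predAbove_of_castSucc_lt _ _ hk, Fin.succAbove_of_le_castSucc _ _ hj]
      change (j : ℕ) + 1 < k ↔ (j : ℕ) < k - 1
      omega
    · rw [Fin.predAbove_of_le_castSucc _ _ hk, Fin.succAbove_of_castSucc_lt _ _ hj]
      rfl
    · rw [Fin.predAbove_of_le_castSucc _ _ hk, Fin.succAbove_of_le_castSucc _ _ hj]
      have hk' : (k : ℕ) ≤ i := hk
      have hj' : (i : ℕ) ≤ j := hj
      change (j : ℕ) + 1 < k ↔ (j : ℕ) < k
      omega

theorem glue_eq_ofNat {n : ℕ} (k : Fin (n + 2)) :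
    PreLogHom.Bar.glue n k = Fin.ofNat (n + 1) k := by
  cases k using Fin.lastCases with
  | last => rw [PreLogHom.Bar.glue_last]; ext; simp
  | cast i => rw [PreLogHom.Bar.glue_castSucc]; ext; simp

/-- The circle is the interval with its ends identified: both actions count the same set, and `glue`
is reduction modulo the number of simplices of the circle. -/
theorem glue_comp_interval {m n : SimplexCategory} (θ : m ⟶ n) :
    PreLogHom.Bar.glue m.len ∘ interval θ = circle θ ∘ PreLogHom.Bar.glue n.len := by
  funext k
  cases k using Fin.lastCases with
  | last => rw [Function.comp_apply, Function.comp_apply, interval_last, PreLogHom.Bar.glue_last,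
      PreLogHom.Bar.glue_last, circle_zero]
  | cast i =>
    rw [Function.comp_apply, Function.comp_apply, PreLogHom.Bar.glue_castSucc, glue_eq_ofNat]
    rfl

/-! ### The bar resolution -/

namespace PreLogHom

variable {X Y : PreLogRing.{u}} (f : PreLogHom X Y)

/-- `B_{n+2}`, as a `B_2`-algebra through the first and the last position. -/
def EBar (n : ℕ) : Type u := f.Bar (n + 2)

instance (n : ℕ) : CommRing (f.EBar n) := inferInstanceAs (CommRing (f.Bar (n + 2)))

instance (n : ℕ) : Algebra (f.Bar 2) (f.EBar n) := (Bar.map f (Bar.ends n)).toAlgebra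

/-- The `B_2`-algebra homomorphism `B_{n+2} → B_{m+2}` induced by a monotone map `[m] → [n]`. -/
def EBar.map {m n : SimplexCategory} (θ : m ⟶ n) : f.EBar n.len →ₐ[f.Bar 2] f.EBar m.len :=
  { Bar.map f (interval θ) with
    commutes' := fun a => by
      have := RingHom.congr_fun (Bar.map_comp f (Bar.ends n.len) (interval θ)) a
      rwa [interval_comp_ends] at this }

/-- The two-sided bar construction, a simplicial `B_2`-module. -/
def barResolution : SimplicialObject (ModuleCat.{u} (f.Bar 2)) where
  obj n := ModuleCat.of (f.Bar 2) (f.EBar n.unop.len)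
  map θ := ModuleCat.ofHom (EBar.map f θ.unop).toLinearMap
  map_id n := by
    ext x
    have h : Bar.map f (interval (𝟙 n.unop)) = RingHom.id _ := by rw [interval_id, Bar.map_id]
    exact RingHom.congr_fun h x
  map_comp θ ψ := by
    ext x
    have h : Bar.map f (interval (ψ.unop ≫ θ.unop)) =
        (Bar.map f (interval ψ.unop)).comp (Bar.map f (interval θ.unop)) := by
      rw [interval_comp, Bar.map_comp]
    exact RingHom.congr_fun h x

/-- The chain complex of the two-sided bar construction. -/
def barResolutionComplex : ChainComplex (ModuleCat.{u} (f.Bar 2)) ℕ :=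
  (AlgebraicTopology.alternatingFaceMapComplex _).obj f.barResolution

/-- The differential of the bar resolution. -/
def barD (n : ℕ) : f.Bar (n + 3) →+ f.Bar (n + 2) :=
  ∑ i : Fin (n + 2), (-1 : ℤ) ^ (i : ℕ) • (Bar.map f i.predAbove : _ →+ f.Bar (n + 2))

theorem barD_apply (n : ℕ) (x : f.Bar (n + 3)) :
    barD f n x = ∑ i : Fin (n + 2), (-1 : ℤ) ^ (i : ℕ) • Bar.map f i.predAbove x := by
  simp [barD]

theorem barResolutionComplex_d_apply (n : ℕ) (x : f.Bar (n + 3)) :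
    (f.barResolutionComplex.d (n + 1) n).hom x = barD f n x := by
  have hδ (i : Fin (n + 2)) (x : f.Bar (n + 3)) :
      (f.barResolution.δ i).hom x = Bar.map f i.predAbove x :=
    RingHom.congr_fun (congrArg (Bar.map f) (interval_δ i)) x
  -- Evaluation at `x` is additive in the morphism, so it passes through the alternating sum of the
  -- faces.
  let ev : (f.barResolution.obj (Opposite.op (SimplexCategory.mk (n + 1))) ⟶
      f.barResolution.obj (Opposite.op (SimplexCategory.mk n))) →+ f.Bar (n + 2) :=
    AddMonoidHom.mk' (fun g => g.hom x) fun _ _ => rfl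
  refine (congrArg ev
    (AlgebraicTopology.AlternatingFaceMapComplex.obj_d_eq f.barResolution n)).trans ?_
  rw [barD_apply, map_sum]
  exact Finset.sum_congr rfl fun i _ => (map_zsmul ev _ _).trans (congrArg _ (hδ i x))

/-- The shift `s` induced by `Fin.succ` is an extra degeneracy: `d_0 s = id` and `d_{i+1} s = s
d_i`, so `s` is a contracting homotopy. It is additive but moves the first end point; exactness
needs no linearity over `B_2`. -/
theorem barD_map_succ (n : ℕ) (x : f.Bar (n + 3)) :
    barD f (n + 1) (Bar.map f Fin.succ x) = x - Bar.map f Fin.succ (barD f n x) := by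
  have h0 : ((0 : Fin (n + 3)).predAbove) ∘ (Fin.succ : Fin (n + 3) → Fin (n + 4)) = id :=
    funext fun k => by simp
  have hs (i : Fin (n + 2)) : i.succ.predAbove ∘ (Fin.succ : Fin (n + 3) → Fin (n + 4)) =
      Fin.succ ∘ i.predAbove := funext fun k => by simp
  have hc {k l m : ℕ} (c : Fin k → Fin l) (d : Fin l → Fin m) (y : f.Bar k) :
      Bar.map f d (Bar.map f c y) = Bar.map f (d ∘ c) y :=
    RingHom.congr_fun (Bar.map_comp f c d) y
  rw [barD_apply, barD_apply, Fin.sum_univ_succ, map_sum, sub_eq_add_neg, ← Finset.sum_neg_distrib]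
  refine congrArg₂ (· + ·) ?_ ?_
  · rw [hc, h0, Bar.map_id]
    simp
  · refine Finset.sum_congr rfl fun i _ => ?_
    rw [hc, hs, map_zsmul, hc, Fin.val_succ, pow_succ, mul_neg_one, neg_smul]

/-- The lowest degree of the contraction: `d_1 s` sends both positions to `1`, hence is the
augmentation followed by its section `ι 1`. -/
theorem barD_map_succ_zero (x : f.Bar 2) :
    barD f 0 (Bar.map f Fin.succ x) = x - Bar.ι f 2 1 (Bar.fold f 2 x) := by
  have h0 : ((0 : Fin 2).predAbove) ∘ (Fin.succ : Fin 2 → Fin 3) = id := by decide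
  have h1 : ((1 : Fin 2).predAbove) ∘ (Fin.succ : Fin 2 → Fin 3) = fun _ => 1 := by decide
  have hc (d : Fin 3 → Fin 2) :
      Bar.map f d (Bar.map f (Fin.succ : Fin 2 → Fin 3) x) = Bar.map f (d ∘ Fin.succ) x :=
    RingHom.congr_fun (Bar.map_comp f Fin.succ d) x
  have hfold : Bar.map f (fun _ : Fin 2 => (1 : Fin 2)) =
      (Bar.ι f 2 1).comp (Bar.fold f 2) := Bar.hom_ext 0
    (fun j a => by rw [Bar.map_ι, RingHom.comp_apply, Bar.fold_ι])
    (fun j m => by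
      rw [Bar.map_ratio, RingHom.comp_apply, Bar.fold_ratio, map_one, Bar.ratio_self,
        Units.val_one])
  rw [barD_apply, Fin.sum_univ_two, hc, hc, h0, h1, Bar.map_id, hfold]
  simp [sub_eq_add_neg]

theorem fold_barD (x : f.Bar 3) : Bar.fold f 2 (barD f 0 x) = 0 := by
  have hfold (c : Fin 3 → Fin 2) : (Bar.fold f 2).comp (Bar.map f c) = Bar.fold f 3 :=
    Bar.hom_ext 0 (fun j a => by rw [RingHom.comp_apply, Bar.map_ι, Bar.fold_ι, Bar.fold_ι])
      (fun j m => by rw [RingHom.comp_apply, Bar.map_ratio, Bar.fold_ratio, Bar.fold_ratio])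
  have h (c : Fin 3 → Fin 2) : Bar.fold f 2 (Bar.map f c x) = Bar.fold f 3 x :=
    RingHom.congr_fun (hfold c) x
  rw [barD_apply, Fin.sum_univ_two, map_add, map_zsmul, map_zsmul, h, h]
  simp

/-- `A` as a module over `B_2` through the augmentation. -/
abbrev augmentationModule : ModuleCat.{u} (f.Bar 2) :=
  (ModuleCat.restrictScalars (Bar.fold f 2)).obj (ModuleCat.of Y.Ring Y.Ring)

/-- The augmentation of the bar resolution. -/
def barAugmentation : f.barResolutionComplex.X 0 ⟶ f.augmentationModule :=
  ModuleCat.ofHom (X := f.EBar 0) (Y := f.augmentationModule)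
    { toFun := Bar.fold f 2
      map_add' := map_add (Bar.fold f 2)
      map_smul' := fun b (x : f.Bar 2) => by
        -- In degree zero the two end points are all the positions, so `B_2` acts on itself by
        -- multiplication.
        have h : Bar.map f (Bar.ends 0) = RingHom.id _ := by
          rw [show Bar.ends 0 = id by decide, Bar.map_id]
        change Bar.fold f 2 (Bar.map f (Bar.ends 0) b * x) = Bar.fold f 2 b * Bar.fold f 2 x
        rw [h, map_mul]
        rfl }

theorem d_comp_barAugmentation :
    f.barResolutionComplex.d 1 0 ≫ f.barAugmentation = 0 := by
  refine ModuleCat.hom_ext (LinearMap.ext fun x => ?_)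
  exact (congrArg f.barAugmentation.hom (barResolutionComplex_d_apply f 0 x)).trans (fold_barD f x)

instance : Epi f.barAugmentation :=
  (ModuleCat.epi_iff_surjective _).mpr fun a => ⟨Bar.ι f 2 0 a, Bar.fold_ι f 0 a⟩

theorem barResolution_exact_zero :
    (ShortComplex.mk _ _ f.d_comp_barAugmentation).Exact := by
  refine (ShortComplex.moduleCat_exact_iff _).mpr fun x hx => ?_
  change f.Bar 2 at x
  refine ⟨Bar.map f Fin.succ x, ?_⟩
  refine (barResolutionComplex_d_apply f 0 _).trans ((barD_map_succ_zero f x).trans ?_)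
  have : Bar.fold f 2 x = 0 := hx
  rw [this, map_zero, sub_zero]

theorem barResolution_exact_succ (n : ℕ) : (ShortComplex.mk _ _
    (f.barResolutionComplex.d_comp_d (n + 2) (n + 1) n)).Exact := by
  refine (ShortComplex.moduleCat_exact_iff _).mpr fun x hx => ?_
  change f.Bar (n + 3) at x
  refine ⟨Bar.map f Fin.succ x, ?_⟩
  refine (barResolutionComplex_d_apply f (n + 1) _).trans ((barD_map_succ f n x).trans ?_)
  have : barD f n x = 0 := (barResolutionComplex_d_apply f n x).symm.trans hx
  rw [this, map_zero, sub_zero]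

/-! ### The cyclic bar construction as a base change of the bar resolution -/

/-- The `B_2`-linear map `B_{n+2} → B_{n+1}` that identifies the end points. -/
def glueHom (n : ℕ) : ModuleCat.of (f.Bar 2) (f.EBar n) ⟶
    (ModuleCat.restrictScalars (Bar.fold f 2)).obj (ModuleCat.of Y.Ring (f.CBar n)) :=
  ModuleCat.ofHom (X := f.EBar n)
    (Y := (ModuleCat.restrictScalars (Bar.fold f 2)).obj (ModuleCat.of Y.Ring (f.CBar n)))
    { toFun := Bar.map f (Bar.glue n)
      map_add' := map_add (Bar.map f (Bar.glue n))
      map_smul' := fun b (x : f.Bar (n + 2)) => by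
        change Bar.map f (Bar.glue n) (Bar.map f (Bar.ends n) b * x) =
          Bar.ι f (n + 1) 0 (Bar.fold f 2 b) * Bar.map f (Bar.glue n) x
        rw [map_mul]
        exact congrArg (· * _) (RingHom.congr_fun (Bar.map_glue_comp_map_ends f n) b) }

/-- The `A`-linear map `A ⊗_{B_2} B_{n+2} → B_{n+1}`. -/
def extendGlueHom (n : ℕ) :
    (ModuleCat.extendScalars.{u, u, u} (Bar.fold f 2)).obj (ModuleCat.of (f.Bar 2) (f.EBar n)) ⟶
      ModuleCat.of Y.Ring (f.CBar n) :=
  ((ModuleCat.extendRestrictScalarsAdj (Bar.fold f 2)).homEquiv _ _).symm (f.glueHom n)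

theorem extendGlueHom_tmul (n : ℕ) (a : Y.Ring) (x : f.Bar (n + 2)) :
    letI := (Bar.fold f 2).toAlgebra
    (f.extendGlueHom n).hom (TensorProduct.tmul (f.Bar 2) a (x : f.EBar n)) =
      Bar.ι f (n + 1) 0 a * Bar.map f (Bar.glue n) x :=
  rfl

/-- Gluing the ends has the universal property of `A ⊗_{B_2} B_{n+2}`, by `exists_lift_glue` and
`hom_ext_glue`. -/
theorem isIso_extendGlueHom (n : ℕ) : IsIso (f.extendGlueHom n) := by
  rw [ConcreteCategory.isIso_iff_bijective]
  let := (Bar.fold f 2).toAlgebra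
  let : Algebra (f.EBar n) (f.CBar n) := (Bar.map f (Bar.glue n)).toAlgebra
  let : Algebra (f.Bar 2) (f.CBar n) :=
    ((Bar.map f (Bar.glue n)).comp (Bar.map f (Bar.ends n))).toAlgebra
  have : IsScalarTower (f.Bar 2) (f.EBar n) (f.CBar n) := .of_algebraMap_eq fun _ => rfl
  have : IsScalarTower (f.Bar 2) Y.Ring (f.CBar n) :=
    .of_algebraMap_eq (RingHom.congr_fun (Bar.map_glue_comp_map_ends f n))
  have h : Algebra.IsPushout (f.Bar 2) Y.Ring (f.EBar n) (f.CBar n) :=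
    Algebra.isPushout_of_universal
      (fun T _ p q hpq => Bar.exists_lift_glue f n T p q hpq)
      (fun T _ d d' _ hd => Bar.hom_ext_glue f n T d d' hd)
  -- The isomorphism supplied by the pushout square is compared with the adjoint of `glueHom` on
  -- pure tensors.
  have key (x : TensorProduct (f.Bar 2) Y.Ring (f.EBar n)) :
      h.out.equiv x = (f.extendGlueHom n).hom x := by
    induction x using TensorProduct.induction_on with
    | zero => rw [map_zero]; exact (map_zero _).symm
    | tmul a x =>
      rw [IsBaseChange.equiv_tmul, Algebra.smul_def]
      rfl
    | add x y hx hy => rw [map_add, hx, hy]; exact (map_add _ x y).symm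
  have e : ⇑(f.extendGlueHom n).hom = h.out.equiv := (funext key).symm
  exact (congrArg Function.Bijective e).mpr h.out.equiv.bijective

/-- By linearity over `A` it suffices to test on tensors `1 ⊗ x`, where the claim is
`glue_comp_interval`. -/
theorem extendGlueHom_naturality {m n : SimplexCategory} (θ : m ⟶ n) :
    (ModuleCat.extendScalars.{u, u, u} (Bar.fold f 2)).map (f.barResolution.map θ.op) ≫
      f.extendGlueHom m.len = f.extendGlueHom n.len ≫ f.cyclicBar.map θ.op := by
  refine ModuleCat.ExtendScalars.hom_ext fun (x : f.Bar (n.len + 2)) => ?_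
  have h : Bar.map f (Bar.glue m.len) (Bar.map f (interval θ) x) =
      Bar.map f (circle θ) (Bar.map f (Bar.glue n.len) x) := by
    rw [← RingHom.comp_apply, ← RingHom.comp_apply, Bar.map_comp, Bar.map_comp, glue_comp_interval]
  refine (extendGlueHom_tmul f m.len 1 (Bar.map f (interval θ) x)).trans (Eq.trans ?_
    (congrArg (Bar.map f (circle θ)) (extendGlueHom_tmul f n.len 1 x)).symm)
  rw [map_one, one_mul, map_one, one_mul, h]

/-- The base change of the bar resolution to `A` is the cyclic bar construction. -/
def extendBarResolutionIso :
    ((SimplicialObject.whiskering _ _).obj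
      (ModuleCat.extendScalars.{u, u, u} (Bar.fold f 2))).obj f.barResolution ≅ f.cyclicBar :=
  NatIso.ofComponents
    (fun n => @asIso _ _ _ _ (f.extendGlueHom n.unop.len) (f.isIso_extendGlueHom n.unop.len))
    (fun θ => extendGlueHom_naturality f θ.unop)

/-- The base change of the bar resolution to `A` is the cyclic bar complex. -/
def extendBarResolutionComplexIso :
    ((ModuleCat.extendScalars.{u, u, u} (Bar.fold f 2)).mapHomologicalComplex
      (ComplexShape.down ℕ)).obj f.barResolutionComplex ≅ f.cyclicBarComplex :=
  eqToIso (Functor.congr_obj (AlgebraicTopology.map_alternatingFaceMapComplex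
    (ModuleCat.extendScalars.{u, u, u} (Bar.fold f 2))) f.barResolution) ≪≫
  (AlgebraicTopology.alternatingFaceMapComplex _).mapIso f.extendBarResolutionIso

/-- Log Hochschild homology is computed by the replete cyclic bar complex if `A → B_2` is flat. -/
theorem nonempty_logHH_iso_of_flat [HasDerivedCategory.{w} (ModuleCat.{u} Y.Ring)]
    (h : (Bar.ι f 2 0).Flat) : Nonempty (f.logHH ≅ toDerived f.cyclicBarComplex) := by
  have hflat (n : ℕ) : Module.Flat (f.Bar 2) (f.barResolutionComplex.X n) :=
    Bar.flat_map_ends f h n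
  obtain ⟨e⟩ := nonempty_derivedTensor_iso (Bar.fold f 2) f.augmentationModule
    f.barResolutionComplex f.barAugmentation f.d_comp_barAugmentation inferInstance
    f.barResolution_exact_zero f.barResolution_exact_succ
  exact ⟨e ≪≫ DerivedCategory.Q.mapIso
    ((ComplexShape.embeddingDownNat.extendFunctor _).mapIso f.extendBarResolutionComplexIso)⟩

end PreLogHom
end LogHH

end

theorem mainTheorem6 {X Y : LogHH.PreLogRing.{u}} (f : LogHH.PreLogHom X Y)
    {P₁ P₂ M₁ M₂ : Type u} [CommMonoid P₁] [CommGroup P₂] [CommMonoid M₁] [CommGroup M₂]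
    (eP : P₁ × P₂ ≃* X.Mon) (eM : M₁ × M₂ ≃* Y.Mon)
    (φ₁ : P₁ →* M₁) (φ₂ : P₂ →* M₂)
    (hφ : ∀ p : P₁ × P₂, f.mon (eP p) = eM (φ₁ p.1, φ₂ p.2))
    (hflat : (f.chartMap eP eM φ₁ φ₂ hφ).Flat)
    [HasDerivedCategory.{w} (ModuleCat.{u} Y.Ring)] :
    Nonempty (f.logHH ≅ LogHH.toDerived f.cyclicBarComplex) :=
  f.nonempty_logHH_iso_of_flat (f.flat_ι_zero eP eM φ₁ φ₂ hφ hflat)
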